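/- Let $d\ge 1$ and let $\Omega\subset\mathbb{R}^d$ be a domain (nonempty, open, connected). Let $H_0^2(\Omega)$ be the closure of $C_c^\infty(\Omega)$ in the norm $(\|u\|_{L^2}^2+\|\Delta u\|_{L^2}^2)^{1/2}$ (functions are extended by zero to $\mathbb{R}^d$), and let $$\Lambda(\Omega)=\inf_{0\ne u\in H_0^2(\Omega)}\frac{\int |\Delta u|^2}{\int|\nabla u|^2}=\inf_{0\ne u\in H_0^2(\Omega)}\frac{\int_{\mathbb{R}^d}(2\pi|\xi|)^4|\widehat u(\xi)|^2\,d\xi}{\int_{\mathbb{R}^d}(2\pi|\xi|)^2|\widehat u(\xi)|^2\,d\xi},\qquad \widehat u(\xi)=\int u(x)e^{-2\pi i \xi\cdot x}\,dx,$$ be its lowest buckling eigenvalue; for bounded $\Omega$ this is the principal eigenvalue of $\Delta^2u+\Lambda\Delta u=0$ in $\Omega$ with $u=\partial u/\partial\nu=0$ on $\partial\Omega$. Let $G=\{U\in O(d): U(\Omega)=\Omega\}$ be the isometry group of $\Omega$, and suppose that $G$ admits $2$-frames, that is, every $G$-invariant homogeneous polynomial of degree $4$ on $\mathbb{R}^d$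 is a scalar multiple of $|x|^4$. For a matrix $A$ with singular values $s_1,\dots,s_d$ let $\|A\|_n=(\sum_i s_i^n)^{1/n}$ be its Schatten norm of order $n$. Then for every invertible linear map $T:\mathbb{R}^d\to\mathbb{R}^d$ $$\Lambda(T(\Omega))\le\frac{\|T^{-1}\|_2^4+2\|T^{-1}\|_4^4}{(d+2)\,\|T^{-1}\|_2^2}\;\Lambda(\Omega).$$ Equivalently, writing $V$ for the volume and $I_m(D)=\int_D|x|^m\,dx$, and assuming for this formulation that $I_4(\Omega)<\infty$ (for example, that $\Omega$ is bounded), the quantity $$\Lambda V^{2/d}\Big|_{T(\Omega)}\cdot\frac{V^{2/d}I_2}{I_4}\Big|_{T^{-1}(\Omega)},$$ as a function of the invertible linear map $T$, attains its maximum at every $T=cU$ with $c\neq0$ and $U$ orthogonal. -/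

import Mathlib

open MeasureTheory
open scoped ENNReal FourierTransform SchwartzMap

noncomputable section

namespace Buckling

/-- The Euclidean space `ℝ^d`. -/
abbrev Rd (d : ℕ) : Type := EuclideanSpace ℝ (Fin d)

/-- The space `L²(ℝ^d)` of complex-valued functions. -/
abbrev L2 (d : ℕ) : Type := Lp (α := Rd d) ℂ 2 volume

/-! ### Sobolev space and buckling eigenvalue -/

/-- `∫ (2π|ξ|)^(2k) |û(ξ)|² dξ` for `u ∈ L²(ℝ^d)`, with values in `[0, ∞]`. The Fourier transform is
`û(ξ) = ∫ u(x) exp(-2πi ξ·x) dx`, so that `-Δ` has the symbol `(2π|ξ|)²`. The value is `‖u‖²` for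
`k = 0`, the Dirichlet integral `∫ |∇u|²` for `k = 1`, and `∫ |Δu|²` for `k = 2`. -/
def energy {d : ℕ} (k : ℕ) (u : L2 d) : ℝ≥0∞ :=
  ∫⁻ ξ : Rd d, ENNReal.ofReal ((2 * Real.pi * ‖ξ‖) ^ (2 * k) * ‖(𝓕 u : L2 d) ξ‖ ^ 2)

/-- The Sobolev space `H₀²(Ω)`: the closure of `C_c^∞(Ω)` in the norm `(‖u‖² + ∫ |Δu|²)^(1/2)`
(functions are extended by zero to `ℝ^d`). -/
def H02 {d : ℕ} (Ω : Set (Rd d)) : Set (L2 d) :=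
  {u | ∀ ε : ℝ≥0∞, 0 < ε → ∃ φ : 𝓢(Rd d, ℂ), HasCompactSupport φ ∧ tsupport φ ⊆ Ω ∧
    energy 0 (u - φ.toLp 2 volume) + energy 2 (u - φ.toLp 2 volume) < ε}

/-- The lowest buckling eigenvalue of the clamped plate `Ω`,
`Λ(Ω) = inf { ∫ |Δu|² / ∫ |∇u|² : u ∈ H₀²(Ω), u ≠ 0 }`. -/
def bucklingEigenvalue {d : ℕ} (Ω : Set (Rd d)) : ℝ :=
  sInf {r : ℝ | ∃ u ∈ H02 Ω, u ≠ 0 ∧ r = (energy 2 u).toReal / (energy 1 u).toReal}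

/-! ### Symmetries and frames -/

/-- The isometry group of `Ω`: the orthogonal maps `U` of `ℝ^d` with `U(Ω) = Ω`. -/
def isometryGroup {d : ℕ} (Ω : Set (Rd d)) : Subgroup (Rd d ≃ₗᵢ[ℝ] Rd d) where
  carrier := {U | U '' Ω = Ω}
  mul_mem' {U V} hU hV := by
    have h : (⇑(U * V) : Rd d → Rd d) = U ∘ V := rfl
    simp only [Set.mem_ofPred_eq] at hU hV ⊢
    rw [h, Set.image_comp, hV, hU]
  one_mem' := by
    have h : (⇑(1 : Rd d ≃ₗᵢ[ℝ] Rd d) : Rd d → Rd d) = id := rfl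
    simp only [Set.mem_ofPred_eq]
    rw [h, Set.image_id]
  inv_mem' {U} hU := by
    have h : (⇑U⁻¹ : Rd d → Rd d) ∘ U = id := by
      funext x
      exact U.symm_apply_apply x
    simp only [Set.mem_ofPred_eq] at hU ⊢
    conv_lhs => rw [← hU]
    rw [← Set.image_comp, h, Set.image_id]

/-- A group `G` of orthogonal maps of `ℝ^d` admits `p`-frames: up to scalar multiples, `|x|^(2p)` is
the only `G`-invariant homogeneous polynomial of degree `2p`. -/
def AdmitsFrames {d : ℕ} (p : ℕ) (G : Subgroup (Rd d ≃ₗᵢ[ℝ] Rd d)) : Prop :=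
  ∀ q : MvPolynomial (Fin d) ℝ, q.IsHomogeneous (2 * p) →
    (∀ U ∈ G, ∀ x : Rd d,
      MvPolynomial.eval (fun i => (U x) i) q = MvPolynomial.eval (fun i => x i) q) →
    ∃ c : ℝ, ∀ x : Rd d, MvPolynomial.eval (fun i => x i) q = c * ‖x‖ ^ (2 * p)

/-! ### Norms and moments -/

/-- The Schatten norm `‖T‖_n = (s₁^n + ⋯ + s_d^n)^(1/n)`, with `s_i` the singular values of `T`. -/
def schattenNorm {d : ℕ} (n : ℕ) (T : Rd d →ₗ[ℝ] Rd d) : ℝ :=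
  (∑ i ∈ Finset.range d, T.singularValues i ^ n) ^ (1 / (n : ℝ))

/-- The moment `I_m(Ω) = ∫_Ω |x|^m dx`. -/
def moment {d : ℕ} (m : ℕ) (Ω : Set (Rd d)) : ℝ :=
  ∫ x in Ω, ‖x‖ ^ m

/-- The volume `V(Ω)`. -/
def vol {d : ℕ} (Ω : Set (Rd d)) : ℝ := (volume Ω).toReal

/-- The functional `ΛV^{2/d}|_{T(Ω)} · (V^{2/d} I₂ / I₄)|_{T⁻¹(Ω)}` of an invertible linear map `T`. -/
def bucklingFunctional {d : ℕ} (Ω : Set (Rd d)) (T : Rd d ≃ₗ[ℝ] Rd d) : ℝ :=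
  (bucklingEigenvalue (T '' Ω) * vol (T '' Ω) ^ (2 / (d : ℝ))) *
    (vol (T.symm '' Ω) ^ (2 / (d : ℝ)) * moment 2 (T.symm '' Ω) / moment 4 (T.symm '' Ω))

end Buckling

end

/-! For `U` in the isometry group `G` of `Ω` one has `T(Ω) = TU(Ω)`, so each test function `φ` on
`Ω` gives a whole family of trial functions `φ ∘ (TU)⁻¹` on `T(Ω)`. On the Fourier side, with `B`
the adjoint of `T⁻¹`, the variational inequality for this family reads `Λ(T(Ω)) ∫ (2π|BUξ|)² |φ̂|² ≤
∫ (2π|BUξ|)⁴ |φ̂|²`, because the Jacobian factors of the two energies coincide. Averaging over `G`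
replaces `|BUξ|⁴` by an invariant quartic and `|BUξ|²` by an invariant quadratic. The frame
condition makes these multiples of `|ξ|⁴` and `|ξ|²`, and integration over the unit ball, where all
of `O(d)` acts, identifies the constants as `quarticMean B` and `quadraticMean B`. What remains is
an inequality between the energies of `φ` itself, and density of test functions turns it into the
bound on `Λ(T(Ω))`.

No Haar measure on `G` is used. The average is a fixed point of `G` in the closed convex hull of an
orbit in a finite-dimensional space of polynomial functions, and linear inequalities valid on the
orbit pass to it; `AdmitsFrames.le_average` packages this.

For the functional, the same averaging applied to Lebesgue measure on `Ω` shows that the moment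
ratio of `T⁻¹(Ω)` carries exactly the reciprocal of the factor in the eigenvalue bound. The product
is thus at most its value at the identity, and similarities reach that value by scaling. -/

noncomputable section

namespace Buckling

/-! ### A fixed point in the closed convex hull of an orbit -/

theorem exists_fixed_mem_closure_convexHull {V ι : Type*} [NormedAddCommGroup V]
    [InnerProductSpace ℝ V] [FiniteDimensional ℝ V] [Nonempty ι] (ρ : ι → V →ₗ[ℝ] V)
    (hcomp : ∀ g h, ∃ k, ∀ x, ρ h (ρ g x) = ρ k x) (hnorm : ∀ g x, ‖ρ g x‖ = ‖x‖) (v : V) :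
    ∃ w ∈ closure (convexHull ℝ (Set.range fun g => ρ g v)), ∀ g, ρ g w = w := by
  set K := closure (convexHull ℝ (Set.range fun g => ρ g v)) with hK
  have hne : K.Nonempty := (Set.range_nonempty _).convexHull.closure
  have hconv : Convex ℝ K := (convex_convexHull ℝ _).closure
  have hinv : ∀ h, ∀ x ∈ K, ρ h x ∈ K := by
    intro h x hx
    have hc : Continuous (ρ h) := (ρ h).continuous_of_finiteDimensional
    refine map_mem_closure hc hx ?_
    intro y hy
    have : ρ h y ∈ ρ h '' convexHull ℝ (Set.range fun g => ρ g v) := ⟨y, hy, rfl⟩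
    rw [LinearMap.image_convexHull] at this
    refine convexHull_mono ?_ this
    rintro _ ⟨_, ⟨g, rfl⟩, rfl⟩
    obtain ⟨k, hk⟩ := hcomp g h
    exact ⟨k, (hk v).symm⟩
  -- The fixed point is the element of least norm in `K`: the maps are isometries that send `K` into
  -- itself.
  obtain ⟨w, hwK, hw⟩ := exists_norm_eq_iInf_of_complete_convex hne
    isClosed_closure.isComplete hconv 0
  have hmin : ∀ y ∈ K, ‖w‖ ≤ ‖y‖ := by
    intro y hy
    have h1 : ‖(0 : V) - w‖ ≤ ‖(0 : V) - y‖ := by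
      rw [hw]
      exact ciInf_le ⟨0, by rintro _ ⟨z, rfl⟩; positivity⟩ (⟨y, hy⟩ : K)
    simpa using h1
  refine ⟨w, hwK, fun g => ?_⟩
  -- If `ρ g w ≠ w`, the parallelogram law would make their midpoint strictly shorter than `w`.
  have hmid : (1 / 2 : ℝ) • ρ g w + (1 / 2 : ℝ) • w ∈ K :=
    hconv (hinv g w hwK) hwK (by norm_num) (by norm_num) (by norm_num)
  have h1 := hmin _ hmid
  have h2 : ‖(1 / 2 : ℝ) • ρ g w + (1 / 2 : ℝ) • w‖ = 1 / 2 * ‖ρ g w + w‖ := by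
    rw [← smul_add, norm_smul]; norm_num
  have h3 := parallelogram_law_with_norm ℝ (ρ g w) w
  rw [h2] at h1
  rw [hnorm] at h3
  have h4 : ‖ρ g w - w‖ = 0 := by
    have := norm_nonneg (ρ g w - w)
    have := norm_nonneg w
    nlinarith
  exact sub_eq_zero.mp (norm_eq_zero.mp h4)

/-- A family of linear maps closed under composition and preserving an inner product `B` fixes a
vector on which every linear functional is at least its infimum over the orbit of `v`. -/
theorem exists_fixed_of_invariant_form {V ι : Type*} [AddCommGroup V] [Module ℝ V]
    [FiniteDimensional ℝ V] [Nonempty ι] (B : V →ₗ[ℝ] V →ₗ[ℝ] ℝ)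
    (hsymm : ∀ x y, B x y = B y x) (hnonneg : ∀ x, 0 ≤ B x x) (hdef : ∀ x, B x x = 0 → x = 0)
    (ρ : ι → V →ₗ[ℝ] V) (hcomp : ∀ g h, ∃ k, ∀ x, ρ h (ρ g x) = ρ k x)
    (hB : ∀ g x, B (ρ g x) (ρ g x) = B x x) (v : V) :
    ∃ w, (∀ g, ρ g w = w) ∧ ∀ (ℓ : V →ₗ[ℝ] ℝ) (c : ℝ), (∀ g, c ≤ ℓ (ρ g v)) → c ≤ ℓ w := by
  let core : InnerProductSpace.Core ℝ V :=
    { inner := fun x y => B x y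
      conj_inner_symm := fun x y => by simp [hsymm x y]
      re_inner_nonneg := fun x => by simpa using hnonneg x
      add_left := fun x y z => by simp
      smul_left := fun x y r => by simp
      definite := hdef }
  let _ : NormedAddCommGroup V := core.toNormedAddCommGroup
  let _ : InnerProductSpace ℝ V := InnerProductSpace.ofCore core.toCore
  have hn : ∀ x : V, ‖x‖ ^ 2 = B x x := fun x => (real_inner_self_eq_norm_sq x).symm
  obtain ⟨w, hwK, hw⟩ := exists_fixed_mem_closure_convexHull ρ hcomp
    (fun g x => by
      have : ‖ρ g x‖ ^ 2 = ‖x‖ ^ 2 := by rw [hn, hn, hB]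
      exact (sq_eq_sq₀ (norm_nonneg _) (norm_nonneg _)).mp this) v
  refine ⟨w, hw, fun ℓ c hc => ?_⟩
  have hcont : Continuous ℓ := ℓ.continuous_of_finiteDimensional
  have hclosed : IsClosed {x : V | c ≤ ℓ x} := isClosed_le continuous_const hcont
  have hconv : Convex ℝ {x : V | c ≤ ℓ x} := convex_halfSpace_ge ℓ.isLinear c
  refine closure_minimal (convexHull_min ?_ hconv) hclosed hwK
  rintro _ ⟨g, rfl⟩
  exact hc g

/-! ### Homogeneous polynomial functions -/

/-- The homogeneous polynomial functions of degree `n` on `ℝ^d`. -/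
def homogFun (d n : ℕ) : Submodule ℝ (Rd d → ℝ) where
  carrier := {f | ∃ q : MvPolynomial (Fin d) ℝ, q.IsHomogeneous n ∧
    ∀ x : Rd d, f x = MvPolynomial.eval (fun i => x i) q}
  zero_mem' := ⟨0, MvPolynomial.isHomogeneous_zero _ _ _, fun x => by simp⟩
  add_mem' := by
    rintro f g ⟨p, hp, hf⟩ ⟨q, hq, hg⟩
    exact ⟨p + q, hp.add hq, fun x => by simp [hf, hg]⟩
  smul_mem' := by
    rintro c f ⟨p, hp, hf⟩
    exact ⟨MvPolynomial.C c * p, hp.C_mul c, fun x => by simp [hf]⟩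

variable {d : ℕ}

theorem mem_homogFun {n : ℕ} {f : Rd d → ℝ} : f ∈ homogFun d n ↔
    ∃ q : MvPolynomial (Fin d) ℝ, q.IsHomogeneous n ∧
      ∀ x : Rd d, f x = MvPolynomial.eval (fun i => x i) q := Iff.rfl

instance finiteDimensional_homogFun (n : ℕ) : FiniteDimensional ℝ (homogFun d n) := by
  let e : MvPolynomial (Fin d) ℝ →ₗ[ℝ] (Rd d → ℝ) :=
    { toFun := fun q x => MvPolynomial.eval (fun i => x i) q
      map_add' := fun p q => by ext x; simp
      map_smul' := fun c q => by ext x; simp }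
  have h : homogFun d n = (MvPolynomial.homogeneousSubmodule (Fin d) ℝ n).map e := by
    ext f
    rw [mem_homogFun, Submodule.mem_map]
    exact exists_congr fun q => and_congr_right fun _ =>
      ⟨fun h => (funext h).symm, fun h x => (congrFun h x).symm⟩
  rw [h]
  exact Module.Finite.iff_fg.mpr ((MvPolynomial.homogeneousSubmodule_fg _ _ n).map e)

theorem homogFun_mul {m n : ℕ} {f g : Rd d → ℝ} (hf : f ∈ homogFun d m) (hg : g ∈ homogFun d n) :
    (fun x => f x * g x) ∈ homogFun d (m + n) := by
  obtain ⟨p, hp, hf⟩ := hf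
  obtain ⟨q, hq, hg⟩ := hg
  exact ⟨p * q, hp.mul hq, fun x => by simp [hf, hg]⟩

theorem homogFun_comp {n : ℕ} {f : Rd d → ℝ} (hf : f ∈ homogFun d n) (A : Rd d →ₗ[ℝ] Rd d) :
    (fun x => f (A x)) ∈ homogFun d n := by
  obtain ⟨p, hp, hf⟩ := hf
  let b := EuclideanSpace.basisFun (Fin d) ℝ
  let g : Fin d → MvPolynomial (Fin d) ℝ := fun i =>
    ∑ j, MvPolynomial.C (A (b j) i) * MvPolynomial.X j
  have hg : ∀ i, (g i).IsHomogeneous 1 := fun i =>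
    MvPolynomial.IsHomogeneous.sum _ _ _ fun j _ => MvPolynomial.isHomogeneous_C_mul_X _ _
  refine ⟨MvPolynomial.aeval g p, by simpa using hp.aeval g hg, fun x => ?_⟩
  have hx : ∀ i, MvPolynomial.eval (fun i => x i) (g i) = A x i := by
    intro i
    conv_rhs => rw [← b.sum_repr x]
    simp [g, b, mul_comm]
  have h := MvPolynomial.eval₂Hom_bind₁ (RingHom.id ℝ) (fun i => x i) g p
  change f (A x) = MvPolynomial.eval₂Hom (RingHom.id ℝ) (fun i => x i) (MvPolynomial.bind₁ g p)
  rw [h, hf]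
  change _ = MvPolynomial.eval (fun i => MvPolynomial.eval (fun i => x i) (g i)) p
  simp only [hx]

theorem homogFun_smul {n : ℕ} {f : Rd d → ℝ} (hf : f ∈ homogFun d n) (t : ℝ) (x : Rd d) :
    f (t • x) = t ^ n * f x := by
  obtain ⟨p, hp, hf⟩ := hf
  rw [hf, hf, MvPolynomial.eval_eq', MvPolynomial.eval_eq', Finset.mul_sum]
  refine Finset.sum_congr rfl fun s hs => ?_
  have h : ∑ i, s i = n := by
    have := hp (MvPolynomial.mem_support_iff.mp hs)
    rw [← this, Finsupp.weight_apply, Finsupp.sum_fintype _ _ (by simp)]; simp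
  simp only [PiLp.smul_apply, smul_eq_mul, mul_pow, Finset.prod_mul_distrib,
    Finset.prod_pow_eq_pow_sum, h]
  ring

theorem continuous_homogFun {n : ℕ} {f : Rd d → ℝ} (hf : f ∈ homogFun d n) : Continuous f := by
  obtain ⟨p, hp, hf⟩ := hf
  rw [funext hf]
  exact (MvPolynomial.continuous_eval p).comp (by fun_prop)

/-- Compactness of the unit sphere and homogeneity. This reduces integrability of every form of
degree `n` to that of `‖x‖ ^ n`. -/
theorem exists_abs_le_of_mem_homogFun {n : ℕ} (hn : n ≠ 0) {f : Rd d → ℝ}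
    (hf : f ∈ homogFun d n) : ∃ C, ∀ x, |f x| ≤ C * ‖x‖ ^ n := by
  obtain ⟨C, hC⟩ := (isCompact_sphere (0 : Rd d) 1).exists_bound_of_continuousOn
    (continuous_homogFun hf).continuousOn
  refine ⟨C, fun x => ?_⟩
  rcases eq_or_ne x 0 with rfl | hx
  · have := homogFun_smul hf 0 (0 : Rd d)
    simp [hn] at this
    simp [this, hn]
  · have h1 : x = ‖x‖ • (‖x‖⁻¹ • x) := by
      rw [smul_smul, mul_inv_cancel₀ (norm_ne_zero_iff.mpr hx), one_smul]
    have h2 := hC (‖x‖⁻¹ • x) (by simp [norm_smul, hx])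
    rw [h1, homogFun_smul hf, abs_mul, abs_of_nonneg (by positivity), ← h1, mul_comm]
    exact mul_le_mul_of_nonneg_right h2 (by positivity)

theorem norm_sq_mem_homogFun : (fun x : Rd d => ‖x‖ ^ 2) ∈ homogFun d 2 :=
  ⟨∑ i, MvPolynomial.X i ^ 2, MvPolynomial.IsHomogeneous.sum _ _ _ fun i _ =>
    MvPolynomial.isHomogeneous_X_pow i 2, fun x => by simp [EuclideanSpace.real_norm_sq_eq]⟩

theorem norm_pow_four_mem_homogFun : (fun x : Rd d => ‖x‖ ^ 4) ∈ homogFun d 4 := by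
  convert homogFun_mul (d := d) norm_sq_mem_homogFun norm_sq_mem_homogFun using 2
  ring

theorem AdmitsFrames.eq_const_mul_norm_pow_four {G : Subgroup (Rd d ≃ₗᵢ[ℝ] Rd d)}
    (hG : AdmitsFrames 2 G) {f : Rd d → ℝ} (hf : f ∈ homogFun d 4)
    (hinv : ∀ U ∈ G, ∀ x, f (U x) = f x) : ∃ c, ∀ x, f x = c * ‖x‖ ^ 4 := by
  obtain ⟨q, hq, hf⟩ := hf
  obtain ⟨c, hc⟩ := hG q hq fun U hU x => by rw [← hf, ← hf, hinv U hU]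
  exact ⟨c, fun x => by rw [hf, hc]⟩

/-- An invariant quadratic form times `|x|²` is an invariant quartic, so the condition in degree 4
already controls degree 2. -/
theorem AdmitsFrames.eq_const_mul_norm_sq {G : Subgroup (Rd d ≃ₗᵢ[ℝ] Rd d)}
    (hG : AdmitsFrames 2 G) {f : Rd d → ℝ} (hf : f ∈ homogFun d 2)
    (hinv : ∀ U ∈ G, ∀ x, f (U x) = f x) : ∃ c, ∀ x, f x = c * ‖x‖ ^ 2 := by
  obtain ⟨c, hc⟩ := hG.eq_const_mul_norm_pow_four (homogFun_mul hf norm_sq_mem_homogFun)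
    fun U hU x => by simp [hinv U hU x]
  refine ⟨c, fun x => ?_⟩
  rcases eq_or_ne x 0 with rfl | hx
  · have := homogFun_smul hf 0 (0 : Rd d)
    simp at this
    simp [this]
  · have h : 0 < ‖x‖ ^ 2 := by positivity
    apply mul_right_cancel₀ h.ne'
    rw [hc x]; ring

/-! ### Integrals of homogeneous polynomial functions over the unit ball -/

theorem integrableOn_unitBall {f : Rd d → ℝ} (hf : Continuous f) :
    IntegrableOn f (Metric.ball 0 1) :=
  (hf.continuousOn.integrableOn_compact (isCompact_closedBall (0 : Rd d) 1)).mono_set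
    Metric.ball_subset_closedBall

theorem setIntegral_unitBall_comp (U : Rd d ≃ₗᵢ[ℝ] Rd d) (f : Rd d → ℝ) :
    ∫ x in Metric.ball (0 : Rd d) 1, f (U x) = ∫ x in Metric.ball (0 : Rd d) 1, f x := by
  have h := U.measurePreserving.setIntegral_preimage_emb
    U.toHomeomorph.measurableEmbedding f (Metric.ball 0 1)
  rw [← h, U.preimage_ball, map_zero]

theorem eq_zero_of_setIntegral_sq_eq_zero {n : ℕ} {f : Rd d → ℝ}
    (hf : f ∈ homogFun d n) (h : ∫ x in Metric.ball (0 : Rd d) 1, f x * f x = 0) : f = 0 := by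
  have hc := continuous_homogFun hf
  have h1 := (setIntegral_eq_zero_iff_of_nonneg_ae (Filter.Eventually.of_forall fun x =>
    mul_self_nonneg (f x)) (integrableOn_unitBall (hc.mul hc))).mp h
  have h2 : Set.EqOn (fun x => f x * f x) 0 (Metric.ball 0 1) :=
    Measure.eqOn_open_of_ae_eq h1 Metric.isOpen_ball (hc.mul hc).continuousOn continuousOn_const
  ext x
  -- Homogeneity carries the vanishing on the ball to all of space.
  have hx : (‖x‖ + 1)⁻¹ • x ∈ Metric.ball (0 : Rd d) 1 := by
    rw [mem_ball_zero_iff, norm_smul, norm_inv, Real.norm_of_nonneg (by positivity),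
      inv_mul_lt_one₀ (by positivity)]
    linarith
  have h3 := mul_self_eq_zero.mp (h2 hx)
  rw [homogFun_smul hf] at h3
  exact (mul_eq_zero.mp h3).resolve_left (by positivity)

/-! ### Fourth moments of the unit ball -/

open scoped RealInnerProductSpace in
-- The reflection in the hyperplane orthogonal to `u - v` exchanges `u` and `v` and preserves the
-- ball.
theorem setIntegral_unitBall_inner_pow (n : ℕ) {u v : Rd d} (h : ‖u‖ = ‖v‖) :
    ∫ x in Metric.ball (0 : Rd d) 1, ⟪u, x⟫ ^ n = ∫ x in Metric.ball (0 : Rd d) 1, ⟪v, x⟫ ^ n := by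
  rw [← setIntegral_unitBall_comp (ℝ ∙ (u - v))ᗮ.reflection]
  congr with x
  rw [← LinearIsometryEquiv.inner_map_map (ℝ ∙ (u - v))ᗮ.reflection, Submodule.reflection_sub h,
    Submodule.reflection_reflection]

open scoped RealInnerProductSpace in
theorem setIntegral_unitBall_inner_pow_pos {n : ℕ} (hn : Even n) {u : Rd d} (hu : u ≠ 0) :
    0 < ∫ x in Metric.ball (0 : Rd d) 1, ⟪u, x⟫ ^ n := by
  have hc : Continuous fun x : Rd d => ⟪u, x⟫ ^ n := by fun_prop
  have hnn : ∀ x : Rd d, 0 ≤ ⟪u, x⟫ ^ n := fun x => hn.pow_nonneg _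
  rw [setIntegral_pos_iff_support_of_nonneg_ae (Filter.Eventually.of_forall hnn)
    (integrableOn_unitBall hc)]
  refine (IsOpen.measure_pos _ (hc.isOpen_support.inter Metric.isOpen_ball) ?_)
  refine ⟨(2 * ‖u‖)⁻¹ • u, ?_, ?_⟩
  · simp [inner_smul_right, hu]
  · have : ‖u‖ ≠ 0 := norm_ne_zero_iff.mpr hu
    rw [mem_ball_zero_iff, norm_smul, norm_inv, Real.norm_of_nonneg (by positivity), mul_inv,
      mul_assoc, inv_mul_cancel₀ this]
    norm_num

open scoped RealInnerProductSpace in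
-- Since `u ± v` have length `√2`, their fourth moments are both `4 J u`. Expanding `⟪u + v, x⟫⁴ +
-- ⟪u - v, x⟫⁴` leaves the mixed moment as the only unknown.
theorem setIntegral_unitBall_inner_sq_mul_inner_sq {u v : Rd d} (hu : ‖u‖ = 1) (hv : ‖v‖ = 1)
    (huv : ⟪u, v⟫ = 0) :
    3 * ∫ x in Metric.ball (0 : Rd d) 1, ⟪u, x⟫ ^ 2 * ⟪v, x⟫ ^ 2 =
      ∫ x in Metric.ball (0 : Rd d) 1, ⟪u, x⟫ ^ 4 := by
  set J : Rd d → ℝ := fun u => ∫ x in Metric.ball (0 : Rd d) 1, ⟪u, x⟫ ^ 4 with hJ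
  have hi : ∀ u : Rd d, IntegrableOn (fun x => ⟪u, x⟫ ^ 4) (Metric.ball 0 1) := fun u =>
    integrableOn_unitBall (by fun_prop)
  have hK : IntegrableOn (fun x => ⟪u, x⟫ ^ 2 * ⟪v, x⟫ ^ 2) (Metric.ball 0 1) :=
    integrableOn_unitBall (by fun_prop)
  have hS : IntegrableOn (fun x => 2 * ⟪u, x⟫ ^ 4 + 2 * ⟪v, x⟫ ^ 4) (Metric.ball 0 1) :=
    integrableOn_unitBall (by fun_prop)
  have hadd : ‖u + v‖ = ‖(√2 : ℝ) • u‖ := by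
    rw [← sq_eq_sq₀ (norm_nonneg _) (norm_nonneg _), norm_add_sq_real, norm_smul, mul_pow]
    simp [hu, hv, huv]; norm_num
  have hsub : ‖u - v‖ = ‖(√2 : ℝ) • u‖ := by
    rw [← sq_eq_sq₀ (norm_nonneg _) (norm_nonneg _), norm_sub_sq_real, norm_smul, mul_pow]
    simp [hu, hv, huv]; norm_num
  have h2 : J ((√2 : ℝ) • u) = 4 * J u := by
    have h4 : √2 ^ 4 = 4 := by
      rw [show 4 = 2 * 2 from rfl, pow_mul, Real.sq_sqrt zero_le_two]; norm_num
    simp only [hJ, inner_smul_left, mul_pow, integral_const_mul, RCLike.conj_to_real, h4]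
  have hJadd : J (u + v) = 4 * J u := (setIntegral_unitBall_inner_pow 4 hadd).trans h2
  have hJsub : J (u - v) = 4 * J u := (setIntegral_unitBall_inner_pow 4 hsub).trans h2
  have hJv : J v = J u := setIntegral_unitBall_inner_pow 4 (hv.trans hu.symm)
  have hsum : J (u + v) + J (u - v) = 2 * J u + 2 * J v +
      12 * ∫ x in Metric.ball (0 : Rd d) 1, ⟪u, x⟫ ^ 2 * ⟪v, x⟫ ^ 2 := by
    simp only [hJ]
    rw [← integral_add (hi _) (hi _), ← integral_const_mul, ← integral_const_mul,
      ← integral_const_mul, ← integral_add ((hi _).const_mul 2) ((hi _).const_mul 2),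
      ← integral_add hS (hK.const_mul 12)]
    congr with x
    rw [inner_add_left, inner_sub_left]
    ring
  linarith

/-! ### Power sums of singular values -/

/-- The power sum `s₁^n + ⋯ + s_d^n` of the singular values of `T`. -/
def singularSum (n : ℕ) (T : Rd d →ₗ[ℝ] Rd d) : ℝ :=
  ∑ i : Fin d, T.singularValues i ^ n

theorem schattenNorm_pow {n : ℕ} (hn : n ≠ 0) (T : Rd d →ₗ[ℝ] Rd d) :
    schattenNorm n T ^ n = singularSum n T := by
  have h : 0 ≤ ∑ i ∈ Finset.range d, T.singularValues i ^ n :=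
    Finset.sum_nonneg fun i _ => pow_nonneg (T.singularValues_nonneg i) n
  rw [schattenNorm, one_div, Real.rpow_inv_natCast_pow h hn, singularSum, Finset.sum_range]

open LinearMap in
theorem singularSum_two (T : Rd d →ₗ[ℝ] Rd d) :
    singularSum 2 T = trace ℝ (Rd d) (adjoint T ∘ₗ T) := by
  have hn : Module.finrank ℝ (Rd d) = d := by simp
  rw [T.isSymmetric_adjoint_comp_self.trace_eq_sum_eigenvalues hn]
  exact Finset.sum_congr rfl fun i _ => T.sq_singularValues_fin hn i

open LinearMap in
theorem singularSum_four (T : Rd d →ₗ[ℝ] Rd d) :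
    singularSum 4 T = trace ℝ (Rd d) ((adjoint T ∘ₗ T) ∘ₗ (adjoint T ∘ₗ T)) := by
  have hn : Module.finrank ℝ (Rd d) = d := by simp
  have hT := T.isSymmetric_adjoint_comp_self
  rw [trace_eq_sum_inner _ (hT.eigenvectorBasis hn)]
  refine Finset.sum_congr rfl fun i _ => ?_
  rw [show 4 = 2 * 2 from rfl, pow_mul, T.sq_singularValues_fin hn i, LinearMap.comp_apply,
    hT.apply_eigenvectorBasis hn i, map_smul, hT.apply_eigenvectorBasis hn i]
  simp [inner_smul_right, sq]

open LinearMap in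
-- Cyclicity of the trace. The Fourier side produces the adjoint of `T⁻¹`, whereas the final bound
-- is stated for `T⁻¹`.
theorem singularSum_two_adjoint (T : Rd d →ₗ[ℝ] Rd d) :
    singularSum 2 (adjoint T) = singularSum 2 T := by
  rw [singularSum_two, singularSum_two, adjoint_adjoint, trace_comp_comm']

open LinearMap in
theorem singularSum_four_adjoint (T : Rd d →ₗ[ℝ] Rd d) :
    singularSum 4 (adjoint T) = singularSum 4 T := by
  rw [singularSum_four, singularSum_four, adjoint_adjoint, LinearMap.comp_assoc, trace_comp_comm']
  simp only [LinearMap.comp_assoc]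

open LinearMap in
open scoped RealInnerProductSpace in
-- The basis consists of eigenvectors of `T* T`.
theorem exists_orthonormalBasis_norm_sq_eq (T : Rd d →ₗ[ℝ] Rd d) :
    ∃ b : OrthonormalBasis (Fin d) ℝ (Rd d), ∀ x,
      ‖T x‖ ^ 2 = ∑ i : Fin d, T.singularValues i ^ 2 * ⟪b i, x⟫ ^ 2 := by
  have hn : Module.finrank ℝ (Rd d) = d := by simp
  have hT := T.isSymmetric_adjoint_comp_self
  refine ⟨hT.eigenvectorBasis hn, fun x => ?_⟩
  have h1 : ‖T x‖ ^ 2 = ⟪x, (adjoint T ∘ₗ T) x⟫ := by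
    rw [LinearMap.comp_apply, adjoint_inner_right, real_inner_self_eq_norm_sq]
  rw [h1, ← (hT.eigenvectorBasis hn).sum_inner_mul_inner]
  refine Finset.sum_congr rfl fun i _ => ?_
  rw [← hT, hT.apply_eigenvectorBasis hn i, T.sq_singularValues_fin hn i, inner_smul_left,
    real_inner_comm]
  simp; ring

theorem singularSum_id (n : ℕ) : singularSum n (LinearMap.id : Rd d →ₗ[ℝ] Rd d) = d := by
  have hn : Module.finrank ℝ (Rd d) = d := by simp
  have h : ∀ i : Fin d, (LinearMap.id : Rd d →ₗ[ℝ] Rd d).singularValues i = 1 := by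
    intro i
    have h0 := (LinearMap.id : Rd d →ₗ[ℝ] Rd d).isSymmetric_adjoint_comp_self
    have h1 := h0.apply_eigenvectorBasis hn i
    have h2 := (LinearMap.id : Rd d →ₗ[ℝ] Rd d).sq_singularValues_fin hn i
    have h3 : h0.eigenvectorBasis hn i ≠ 0 := (h0.eigenvectorBasis hn).orthonormal.ne_zero i
    have h4 : (1 : ℝ) = h0.eigenvalues hn i := by
      refine smul_left_injective ℝ h3 ?_
      have h5 : ∀ x, (LinearMap.adjoint (LinearMap.id : Rd d →ₗ[ℝ] Rd d) ∘ₗ LinearMap.id) x = x :=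
        fun x => by simp
      rw [h5] at h1
      simpa only [one_smul, RCLike.ofReal_real_eq_id, id_eq] using h1
    rw [← h4] at h2
    exact (pow_eq_one_iff_of_nonneg (LinearMap.singularValues_nonneg _ _) two_ne_zero).mp h2
  simp [singularSum, h]

open scoped RealInnerProductSpace in
theorem exists_setIntegral_unitBall_norm_sq (hd : d ≠ 0) :
    ∃ m > 0, ∀ B : Rd d →ₗ[ℝ] Rd d,
      ∫ x in Metric.ball (0 : Rd d) 1, ‖B x‖ ^ 2 = m * singularSum 2 B := by
  let e : Rd d := EuclideanSpace.single ⟨0, Nat.pos_of_ne_zero hd⟩ 1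
  have he : ‖e‖ = 1 := by simp [e]
  refine ⟨_, setIntegral_unitBall_inner_pow_pos even_two (u := e) (by
    rintro h; simp [h] at he), fun B => ?_⟩
  obtain ⟨b, hb⟩ := exists_orthonormalBasis_norm_sq_eq B
  simp only [hb]
  rw [integral_finsetSum _ fun i _ => integrableOn_unitBall (by fun_prop), singularSum,
    Finset.mul_sum]
  refine Finset.sum_congr rfl fun i _ => ?_
  rw [integral_const_mul, setIntegral_unitBall_inner_pow 2
    ((b.orthonormal.norm_eq_one i).trans he.symm), mul_comm]

open scoped RealInnerProductSpace in
-- Squaring the diagonal form of `‖B x‖²` gives moments of `⟪b i, x⟫² ⟪b j, x⟫²`, and the diagonal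
-- ones are three times the others. Hence all pairs contribute `singularSum 2 B ^ 2`, and the excess
-- on the diagonal contributes `2 * singularSum 4 B`.
theorem exists_setIntegral_unitBall_norm_pow_four (hd : d ≠ 0) :
    ∃ m > 0, ∀ B : Rd d →ₗ[ℝ] Rd d, ∫ x in Metric.ball (0 : Rd d) 1, ‖B x‖ ^ 4 =
      m * (singularSum 2 B ^ 2 + 2 * singularSum 4 B) := by
  let e : Rd d := EuclideanSpace.single ⟨0, Nat.pos_of_ne_zero hd⟩ 1
  have he : ‖e‖ = 1 := by simp [e]
  have hpos := setIntegral_unitBall_inner_pow_pos (n := 4) (by decide) (u := e) (by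
    rintro h; simp [h] at he)
  set m := ∫ x in Metric.ball (0 : Rd d) 1, ⟪e, x⟫ ^ 4
  refine ⟨m / 3, by positivity, fun B => ?_⟩
  obtain ⟨b, hb⟩ := exists_orthonormalBasis_norm_sq_eq B
  have h1 : ∀ x, ‖B x‖ ^ 4 = ∑ i : Fin d, ∑ j : Fin d,
      B.singularValues i ^ 2 * B.singularValues j ^ 2 * (⟪b i, x⟫ ^ 2 * ⟪b j, x⟫ ^ 2) := by
    intro x
    rw [show 4 = 2 * 2 from rfl, pow_mul, hb, sq, Finset.sum_mul_sum]
    exact Finset.sum_congr rfl fun i _ => Finset.sum_congr rfl fun j _ => by ring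
  have h2 : ∀ i j, ∫ x in Metric.ball (0 : Rd d) 1, ⟪b i, x⟫ ^ 2 * ⟪b j, x⟫ ^ 2 =
      m / 3 * (1 + if i = j then 2 else 0) := by
    intro i j
    have h4 : ∫ x in Metric.ball (0 : Rd d) 1, ⟪b i, x⟫ ^ 4 = m :=
      setIntegral_unitBall_inner_pow 4 ((b.orthonormal.norm_eq_one i).trans he.symm)
    split_ifs with hij
    · subst hij
      simp only [← pow_add, h4]
      ring
    · have := setIntegral_unitBall_inner_sq_mul_inner_sq (b.orthonormal.norm_eq_one i)
        (b.orthonormal.norm_eq_one j) (b.orthonormal.inner_eq_zero hij)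
      linarith
  simp only [h1]
  rw [integral_finsetSum _ fun i _ => integrableOn_unitBall (by fun_prop)]
  have h3 : ∀ i : Fin d, ∫ x in Metric.ball (0 : Rd d) 1, ∑ j : Fin d,
      B.singularValues i ^ 2 * B.singularValues j ^ 2 * (⟪b i, x⟫ ^ 2 * ⟪b j, x⟫ ^ 2) =
      m / 3 * (B.singularValues i ^ 2 * singularSum 2 B + 2 * B.singularValues i ^ 4) := by
    intro i
    rw [integral_finsetSum _ fun i _ => integrableOn_unitBall (by fun_prop)]
    simp only [integral_const_mul, h2, mul_add, Finset.sum_add_distrib, mul_ite, mul_zero,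
      Finset.sum_ite_eq, Finset.mem_univ, if_true, singularSum, Finset.mul_sum]
    congr 1
    · exact Finset.sum_congr rfl fun j _ => by ring
    · ring
  simp only [h3]
  rw [← Finset.mul_sum, Finset.sum_add_distrib, ← Finset.sum_mul, ← Finset.mul_sum]
  simp only [singularSum, sq]

/-! ### Averages over a group that admits frames -/

/-- Composition of homogeneous polynomial functions with a linear map. -/
def homogFunComp (n : ℕ) (A : Rd d →ₗ[ℝ] Rd d) : homogFun d n →ₗ[ℝ] homogFun d n where
  toFun f := ⟨fun x => f.1 (A x), homogFun_comp f.2 A⟩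
  map_add' _ _ := rfl
  map_smul' _ _ := rfl

/-- Integration of homogeneous polynomial functions against a weight. -/
def homogFunIntegral (n : ℕ) (μ : Measure (Rd d)) (w : Rd d → ℝ)
    (hw : ∀ f ∈ homogFun d n, Integrable (fun x => f x * w x) μ) : homogFun d n →ₗ[ℝ] ℝ where
  toFun f := ∫ x, f.1 x * w x ∂μ
  map_add' f g := by
    rw [← integral_add (hw _ f.2) (hw _ g.2)]
    congr with x
    simp [add_mul]
  map_smul' c f := by
    rw [RingHom.id_apply, smul_eq_mul, ← integral_const_mul]
    congr with x
    simp [mul_assoc]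

theorem integrable_homogFun_mul {n : ℕ} (hn : n ≠ 0) {μ : Measure (Rd d)} {w : Rd d → ℝ}
    (hw : AEStronglyMeasurable w μ) (h : Integrable (fun x => ‖x‖ ^ n * w x) μ) {f : Rd d → ℝ}
    (hf : f ∈ homogFun d n) : Integrable (fun x => f x * w x) μ := by
  obtain ⟨C, hC⟩ := exists_abs_le_of_mem_homogFun hn hf
  refine (h.norm.const_mul C).mono' ((continuous_homogFun hf).aestronglyMeasurable.mul hw)
    (Filter.Eventually.of_forall fun x => ?_)
  rw [norm_mul, norm_mul, Real.norm_eq_abs, ← mul_assoc, norm_pow, norm_norm]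
  exact mul_le_mul_of_nonneg_right (hC x) (norm_nonneg _)

theorem integrable_unitBall_homogFun {n : ℕ} (f : Rd d → ℝ) (hf : f ∈ homogFun d n) :
    Integrable (fun x => f x * 1) (volume.restrict (Metric.ball (0 : Rd d) 1)) := by
  simp only [mul_one]
  exact integrableOn_unitBall (continuous_homogFun hf)

theorem integrableOn_unitBall_mul {n : ℕ} (f g : homogFun d n) :
    Integrable (fun x => f.1 x * g.1 x) (volume.restrict (Metric.ball (0 : Rd d) 1)) :=
  integrableOn_unitBall ((continuous_homogFun f.2).mul (continuous_homogFun g.2))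

/-- The `L²` inner product over the unit ball on homogeneous polynomial functions. -/
def ballForm (n : ℕ) : homogFun d n →ₗ[ℝ] homogFun d n →ₗ[ℝ] ℝ :=
  LinearMap.mk₂ ℝ (fun f g => ∫ x in Metric.ball (0 : Rd d) 1, f.1 x * g.1 x)
    (fun f g h => by
      rw [← integral_add (integrableOn_unitBall_mul f h) (integrableOn_unitBall_mul g h)]
      congr with x; simp [add_mul])
    (fun c f g => by
      rw [smul_eq_mul, ← integral_const_mul]
      congr with x; simp [mul_assoc])
    (fun f g h => by
      rw [← integral_add (integrableOn_unitBall_mul f g) (integrableOn_unitBall_mul f h)]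
      congr with x; simp [mul_add])
    (fun c f g => by
      rw [smul_eq_mul, ← integral_const_mul]
      congr with x; simp [mul_left_comm])

theorem ballForm_apply (n : ℕ) (f g : homogFun d n) :
    ballForm n f g = ∫ x in Metric.ball (0 : Rd d) 1, f.1 x * g.1 x := rfl

theorem ballForm_self_nonneg {n : ℕ} (f : homogFun d n) : 0 ≤ ballForm n f f :=
  integral_nonneg fun _ => mul_self_nonneg _

theorem ballForm_comm {n : ℕ} (f g : homogFun d n) : ballForm n f g = ballForm n g f := by
  simp only [ballForm_apply, mul_comm]

theorem ballForm_comp {n : ℕ} (U : Rd d ≃ₗᵢ[ℝ] Rd d) (f : homogFun d n) :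
    ballForm n (homogFunComp n U.toLinearEquiv f) (homogFunComp n U.toLinearEquiv f) =
      ballForm n f f :=
  setIntegral_unitBall_comp U fun x => f.1 x * f.1 x

theorem ballForm_definite {n : ℕ} {f : homogFun d n} (h : ballForm n f f = 0) : f = 0 :=
  Subtype.ext (eq_zero_of_setIntegral_sq_eq_zero f.2 h)

/-- The average of `|Bx|²` over the orthogonal group is `quadraticMean B * |x|²`. -/
def quadraticMean (B : Rd d →ₗ[ℝ] Rd d) : ℝ := singularSum 2 B / d

/-- The average of `|Bx|⁴` over the orthogonal group is `quarticMean B * |x|⁴`. -/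
def quarticMean (B : Rd d →ₗ[ℝ] Rd d) : ℝ :=
  (singularSum 2 B ^ 2 + 2 * singularSum 4 B) / (d * (d + 2))

theorem setIntegral_unitBall_norm_sq (hd : d ≠ 0) (B : Rd d →ₗ[ℝ] Rd d) :
    ∫ x in Metric.ball (0 : Rd d) 1, ‖B x‖ ^ 2 =
      quadraticMean B * ∫ x in Metric.ball (0 : Rd d) 1, ‖x‖ ^ 2 := by
  obtain ⟨m, -, hm⟩ := exists_setIntegral_unitBall_norm_sq hd
  have h := hm LinearMap.id
  simp only [LinearMap.id_apply, singularSum_id] at h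
  have hd' : (d : ℝ) ≠ 0 := Nat.cast_ne_zero.mpr hd
  rw [hm, h, quadraticMean]
  field_simp

theorem setIntegral_unitBall_norm_pow_four (hd : d ≠ 0) (B : Rd d →ₗ[ℝ] Rd d) :
    ∫ x in Metric.ball (0 : Rd d) 1, ‖B x‖ ^ 4 =
      quarticMean B * ∫ x in Metric.ball (0 : Rd d) 1, ‖x‖ ^ 4 := by
  obtain ⟨m, -, hm⟩ := exists_setIntegral_unitBall_norm_pow_four hd
  have h := hm LinearMap.id
  simp only [LinearMap.id_apply, singularSum_id] at h
  have hd' : (d : ℝ) ≠ 0 := Nat.cast_ne_zero.mpr hd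
  have hd'' : (d : ℝ) + 2 ≠ 0 := by positivity
  rw [hm, h, quarticMean]
  field_simp

/-- The averaging principle: a linear inequality in the two weighted integrals that holds along the
whole orbit also holds for the averaged integrands. The quartic and the quadratic are averaged as
one pair, so that an inequality coupling them survives. -/
theorem AdmitsFrames.le_average (hd : d ≠ 0) {G : Subgroup (Rd d ≃ₗᵢ[ℝ] Rd d)}
    (hG : AdmitsFrames 2 G) (B : Rd d →ₗ[ℝ] Rd d) {μ : Measure (Rd d)} {w : Rd d → ℝ}
    (hw : AEStronglyMeasurable w μ) (hw4 : Integrable (fun x => ‖x‖ ^ 4 * w x) μ)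
    (hw2 : Integrable (fun x => ‖x‖ ^ 2 * w x) μ) (a b c : ℝ)
    (h : ∀ U ∈ G, c ≤ a * ∫ x, ‖B (U x)‖ ^ 4 * w x ∂μ + b * ∫ x, ‖B (U x)‖ ^ 2 * w x ∂μ) :
    c ≤ a * (quarticMean B * ∫ x, ‖x‖ ^ 4 * w x ∂μ) +
      b * (quadraticMean B * ∫ x, ‖x‖ ^ 2 * w x ∂μ) := by
  let V := homogFun d 4 × homogFun d 2
  let form : V →ₗ[ℝ] V →ₗ[ℝ] ℝ :=
    (ballForm 4).compl₁₂ (LinearMap.fst ℝ _ _) (LinearMap.fst ℝ _ _) +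
      (ballForm 2).compl₁₂ (LinearMap.snd ℝ _ _) (LinearMap.snd ℝ _ _)
  have hform : ∀ x y : V, form x y = ballForm 4 x.1 y.1 + ballForm 2 x.2 y.2 := fun x y => rfl
  let ρ : G → V →ₗ[ℝ] V := fun U =>
    (homogFunComp 4 (U.1.toLinearEquiv : Rd d →ₗ[ℝ] Rd d)).prodMap
      (homogFunComp 2 (U.1.toLinearEquiv : Rd d →ₗ[ℝ] Rd d))
  let v : V := (⟨_, homogFun_comp norm_pow_four_mem_homogFun B⟩,
    ⟨_, homogFun_comp norm_sq_mem_homogFun B⟩)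
  obtain ⟨⟨p, r⟩, hfix, hmin⟩ := exists_fixed_of_invariant_form form
    (fun x y => by rw [hform, hform, ballForm_comm, ballForm_comm x.2])
    (fun x => add_nonneg (ballForm_self_nonneg _) (ballForm_self_nonneg _))
    (fun x hx => by
      rw [hform] at hx
      have h1 := ballForm_self_nonneg x.1
      have h2 := ballForm_self_nonneg x.2
      exact Prod.ext (ballForm_definite (by linarith)) (ballForm_definite (by linarith)))
    ρ (fun g h => ⟨g * h, fun x => rfl⟩)
    (fun g x => by
      rw [hform, hform]
      exact congrArg₂ (· + ·) (ballForm_comp g.1 x.1) (ballForm_comp g.1 x.2)) v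
  -- A functional constant on the orbit keeps its value at the fixed point, by the lower bound for
  -- `ℓ` and `-ℓ`.
  have heq : ∀ (ℓ : V →ₗ[ℝ] ℝ) (c : ℝ), (∀ g, ℓ (ρ g v) = c) → ℓ (p, r) = c := by
    intro ℓ c hc
    refine le_antisymm ?_ (hmin ℓ c fun g => (hc g).ge)
    have := hmin (-ℓ) (-c) fun g => by simp [hc g]
    simpa using this
  have hfix1 : ∀ U ∈ G, ∀ x, p.1 (U x) = p.1 x := fun U hU x =>
    congrFun (congrArg (fun z : V => z.1.1) (hfix ⟨U, hU⟩)) x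
  have hfix2 : ∀ U ∈ G, ∀ x, r.1 (U x) = r.1 x := fun U hU x =>
    congrFun (congrArg (fun z : V => z.2.1) (hfix ⟨U, hU⟩)) x
  obtain ⟨c4, hc4⟩ := hG.eq_const_mul_norm_pow_four p.2 hfix1
  obtain ⟨c2, hc2⟩ := hG.eq_const_mul_norm_sq r.2 hfix2
  -- The integral over the unit ball is such a functional, which determines the constant
  -- independently of `G`.
  have e4 : c4 = quarticMean B := by
    have h1 := heq ((homogFunIntegral 4 _ _ integrable_unitBall_homogFun).comp
      (LinearMap.fst ℝ _ _)) (∫ x in Metric.ball (0 : Rd d) 1, ‖B x‖ ^ 4)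
      (fun g => by
        rw [← setIntegral_unitBall_comp g.1]
        exact integral_congr_ae (Filter.Eventually.of_forall fun x => mul_one _))
    have h2 : ∫ x in Metric.ball (0 : Rd d) 1, p.1 x * 1 =
      ∫ x in Metric.ball (0 : Rd d) 1, ‖B x‖ ^ 4 := h1
    simp only [mul_one, hc4, integral_const_mul] at h2
    rw [setIntegral_unitBall_norm_pow_four hd] at h2
    obtain ⟨m, hm, hm'⟩ := exists_setIntegral_unitBall_norm_pow_four hd
    have h3 := hm' LinearMap.id
    simp only [LinearMap.id_apply, singularSum_id] at h3
    refine mul_right_cancel₀ ?_ h2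
    have : (0 : ℝ) < d := Nat.cast_pos.mpr (Nat.pos_of_ne_zero hd)
    rw [h3]; positivity
  have e2 : c2 = quadraticMean B := by
    have h1 := heq ((homogFunIntegral 2 _ _ integrable_unitBall_homogFun).comp
      (LinearMap.snd ℝ _ _)) (∫ x in Metric.ball (0 : Rd d) 1, ‖B x‖ ^ 2)
      (fun g => by
        rw [← setIntegral_unitBall_comp g.1]
        exact integral_congr_ae (Filter.Eventually.of_forall fun x => mul_one _))
    have h2 : ∫ x in Metric.ball (0 : Rd d) 1, r.1 x * 1 =
      ∫ x in Metric.ball (0 : Rd d) 1, ‖B x‖ ^ 2 := h1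
    simp only [mul_one, hc2, integral_const_mul] at h2
    rw [setIntegral_unitBall_norm_sq hd] at h2
    obtain ⟨m, hm, hm'⟩ := exists_setIntegral_unitBall_norm_sq hd
    have h3 := hm' LinearMap.id
    simp only [LinearMap.id_apply, singularSum_id] at h3
    refine mul_right_cancel₀ ?_ h2
    have : (0 : ℝ) < d := Nat.cast_pos.mpr (Nat.pos_of_ne_zero hd)
    rw [h3]; positivity
  have key : c ≤ a * ∫ x, p.1 x * w x ∂μ + b * ∫ x, r.1 x * w x ∂μ :=
    hmin (a • (homogFunIntegral 4 μ w fun f hf =>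
        integrable_homogFun_mul four_ne_zero hw hw4 hf).comp (LinearMap.fst ℝ _ _) +
      b • (homogFunIntegral 2 μ w fun f hf =>
        integrable_homogFun_mul two_ne_zero hw hw2 hf).comp (LinearMap.snd ℝ _ _)) c
      fun g => h g.1 g.2
  simpa only [hc4, hc2, e4, e2, mul_assoc, integral_const_mul] using key

theorem AdmitsFrames.integral_norm_pow_four (hd : d ≠ 0) {G : Subgroup (Rd d ≃ₗᵢ[ℝ] Rd d)}
    (hG : AdmitsFrames 2 G) (B : Rd d →ₗ[ℝ] Rd d) {μ : Measure (Rd d)}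
    (hμ4 : Integrable (fun x => ‖x‖ ^ 4) μ) (hμ2 : Integrable (fun x => ‖x‖ ^ 2) μ)
    (hμ : ∀ U ∈ G, MeasurePreserving U μ μ) :
    ∫ x, ‖B x‖ ^ 4 ∂μ = quarticMean B * ∫ x, ‖x‖ ^ 4 ∂μ := by
  have hint : ∀ U ∈ G, ∫ x, ‖B (U x)‖ ^ 4 ∂μ = ∫ x, ‖B x‖ ^ 4 ∂μ := fun U hU =>
    (hμ U hU).integral_comp U.toHomeomorph.measurableEmbedding fun x => ‖B x‖ ^ 4
  -- Invariance of `μ` makes the integral constant on the orbit, so `a = 1` and `a = -1` give the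
  -- two inequalities.
  have h := fun a => hG.le_average hd B (μ := μ) (w := fun _ => 1) aestronglyMeasurable_const
    (by simpa using hμ4) (by simpa using hμ2) a 0 (a * ∫ x, ‖B x‖ ^ 4 ∂μ)
    (fun U hU => by simp [hint U hU])
  have h1 := h 1
  have h2 := h (-1)
  simp only [mul_one, zero_mul, add_zero] at h1 h2
  linarith

theorem AdmitsFrames.integral_norm_sq (hd : d ≠ 0) {G : Subgroup (Rd d ≃ₗᵢ[ℝ] Rd d)}
    (hG : AdmitsFrames 2 G) (B : Rd d →ₗ[ℝ] Rd d) {μ : Measure (Rd d)}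
    (hμ4 : Integrable (fun x => ‖x‖ ^ 4) μ) (hμ2 : Integrable (fun x => ‖x‖ ^ 2) μ)
    (hμ : ∀ U ∈ G, MeasurePreserving U μ μ) :
    ∫ x, ‖B x‖ ^ 2 ∂μ = quadraticMean B * ∫ x, ‖x‖ ^ 2 ∂μ := by
  have hint : ∀ U ∈ G, ∫ x, ‖B (U x)‖ ^ 2 ∂μ = ∫ x, ‖B x‖ ^ 2 ∂μ := fun U hU =>
    (hμ U hU).integral_comp U.toHomeomorph.measurableEmbedding fun x => ‖B x‖ ^ 2
  have h := fun a => hG.le_average hd B (μ := μ) (w := fun _ => 1) aestronglyMeasurable_const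
    (by simpa using hμ4) (by simpa using hμ2) 0 a (a * ∫ x, ‖B x‖ ^ 2 ∂μ)
    (fun U hU => by simp [hint U hU])
  have h1 := h 1
  have h2 := h (-1)
  simp only [mul_one, zero_mul, zero_add] at h1 h2
  linarith

/-! ### The energy of Schwartz functions -/

theorem integral_comp_linearEquiv {F : Type*} [NormedAddCommGroup F] [NormedSpace ℝ F]
    (A : Rd d ≃ₗ[ℝ] Rd d) (f : Rd d → F) :
    ∫ x, f (A x) = |(LinearMap.det (A : Rd d →ₗ[ℝ] Rd d))⁻¹| • ∫ x, f x := by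
  have h := Measure.map_linearMap_addHaar_eq_smul_addHaar (volume : Measure (Rd d))
    (f := (A : Rd d →ₗ[ℝ] Rd d)) A.isUnit_det'.ne_zero
  have h1 : ∫ x, f (A x) = ∫ x, f x ∂(Measure.map (A : Rd d →ₗ[ℝ] Rd d) volume) :=
    (A.toContinuousLinearEquiv.toHomeomorph.measurableEmbedding.integral_map f).symm
  rw [h1, h, integral_smul_measure, ENNReal.toReal_ofReal (abs_nonneg _)]

/-- The weighted integral `∫ (2π|Bξ|)^(2k) |φ̂(ξ)|² dξ`. -/
def weightedEnergy (k : ℕ) (B : Rd d →ₗ[ℝ] Rd d) (φ : 𝓢(Rd d, ℂ)) : ℝ :=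
  ∫ ξ : Rd d, (2 * Real.pi * ‖B ξ‖) ^ (2 * k) * ‖𝓕 φ ξ‖ ^ 2

theorem integrable_norm_pow_mul_norm_sq (m : ℕ) (ψ : 𝓢(Rd d, ℂ)) :
    Integrable fun ξ : Rd d => ‖ξ‖ ^ m * ‖ψ ξ‖ ^ 2 := by
  refine ((ψ.integrable_pow_mul volume m).mul_const (SchwartzMap.seminorm ℝ 0 0 ψ)).mono'
    (by fun_prop) (Filter.Eventually.of_forall fun ξ => ?_)
  rw [Real.norm_of_nonneg (by positivity), sq, ← mul_assoc]
  exact mul_le_mul_of_nonneg_left (ψ.norm_le_seminorm ℝ ξ) (by positivity)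

theorem integrable_weightedEnergy (k : ℕ) (φ : 𝓢(Rd d, ℂ)) :
    Integrable fun ξ : Rd d => (2 * Real.pi * ‖ξ‖) ^ (2 * k) * ‖𝓕 φ ξ‖ ^ 2 := by
  simp only [mul_pow, mul_assoc]
  exact ((integrable_norm_pow_mul_norm_sq (2 * k) (𝓕 φ)).const_mul _).const_mul _

theorem energy_toLp (k : ℕ) (φ : 𝓢(Rd d, ℂ)) :
    energy k (φ.toLp 2 volume) = ENNReal.ofReal (weightedEnergy k LinearMap.id φ) := by
  simp only [weightedEnergy, LinearMap.id_apply]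
  rw [ofReal_integral_eq_lintegral_ofReal (integrable_weightedEnergy k φ)
    (Filter.Eventually.of_forall fun ξ => by positivity), energy, SchwartzMap.toLp_fourier_eq]
  refine lintegral_congr_ae ?_
  filter_upwards [(𝓕 φ).coeFn_toLp 2 volume] with ξ hξ
  rw [hξ]

theorem weightedEnergy_nonneg (k : ℕ) (B : Rd d →ₗ[ℝ] Rd d) (φ : 𝓢(Rd d, ℂ)) :
    0 ≤ weightedEnergy k B φ :=
  integral_nonneg fun _ => by positivity

theorem energy_toLp_ne_top (k : ℕ) (φ : 𝓢(Rd d, ℂ)) : energy k (φ.toLp 2 volume) ≠ ∞ := by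
  rw [energy_toLp]; exact ENNReal.ofReal_ne_top

/-- The Schwartz function `φ ∘ A`. -/
def schwartzComp (A : Rd d ≃ₗ[ℝ] Rd d) (φ : 𝓢(Rd d, ℂ)) : 𝓢(Rd d, ℂ) :=
  SchwartzMap.compCLMOfContinuousLinearEquiv ℂ A.toContinuousLinearEquiv φ

theorem schwartzComp_apply (A : Rd d ≃ₗ[ℝ] Rd d) (φ : 𝓢(Rd d, ℂ)) (x : Rd d) :
    schwartzComp A φ x = φ (A x) := rfl

/-- The adjoint of an invertible linear map. -/
def adjointEquiv (A : Rd d ≃ₗ[ℝ] Rd d) : Rd d ≃ₗ[ℝ] Rd d :=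
  LinearEquiv.ofLinearMap (LinearMap.adjoint (A : Rd d →ₗ[ℝ] Rd d))
    (LinearMap.adjoint (A.symm : Rd d →ₗ[ℝ] Rd d))
    (by rw [← LinearMap.adjoint_comp, LinearEquiv.symm_comp]; simp)
    (by rw [← LinearMap.adjoint_comp, LinearEquiv.comp_symm]; simp)

theorem fourier_schwartzComp (A : Rd d ≃ₗ[ℝ] Rd d) (φ : 𝓢(Rd d, ℂ)) (ξ : Rd d) :
    𝓕 (schwartzComp A φ) ξ =
      |(LinearMap.det (A : Rd d →ₗ[ℝ] Rd d))⁻¹| • 𝓕 φ ((adjointEquiv A).symm ξ) := by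
  rw [SchwartzMap.fourier_coe, SchwartzMap.fourier_coe, Real.fourier_eq, Real.fourier_eq,
    ← integral_comp_linearEquiv]
  congr with v
  rw [schwartzComp_apply]
  congr 3
  have h : inner ℝ (A v) ((adjointEquiv A).symm ξ) =
      inner ℝ v (adjointEquiv A ((adjointEquiv A).symm ξ)) :=
    (LinearMap.adjoint_inner_right (A : Rd d →ₗ[ℝ] Rd d) v _).symm
  rw [h, LinearEquiv.apply_symm_apply]

/-- The point is that `K` does not depend on `k`, so it cancels from the quotient of energies. -/
theorem exists_weightedEnergy_schwartzComp (A : Rd d ≃ₗ[ℝ] Rd d) :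
    ∃ K > 0, ∀ (k : ℕ) (φ : 𝓢(Rd d, ℂ)),
      weightedEnergy k LinearMap.id (schwartzComp A φ) =
        K * weightedEnergy k (LinearMap.adjoint (A : Rd d →ₗ[ℝ] Rd d)) φ := by
  have hA : LinearMap.det (A : Rd d →ₗ[ℝ] Rd d) ≠ 0 := A.isUnit_det'.ne_zero
  have hA' : LinearMap.det ((adjointEquiv A).symm : Rd d →ₗ[ℝ] Rd d) ≠ 0 :=
    (adjointEquiv A).symm.isUnit_det'.ne_zero
  refine ⟨|(LinearMap.det (A : Rd d →ₗ[ℝ] Rd d))⁻¹| ^ 2 *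
    |(LinearMap.det ((adjointEquiv A).symm : Rd d →ₗ[ℝ] Rd d))⁻¹|, by positivity,
    fun k φ => ?_⟩
  rw [mul_assoc, ← smul_eq_mul (|(LinearMap.det ((adjointEquiv A).symm : Rd d →ₗ[ℝ] Rd d))⁻¹|),
    weightedEnergy, weightedEnergy, ← integral_comp_linearEquiv, ← integral_const_mul]
  congr with ξ
  have h : LinearMap.adjoint (A : Rd d →ₗ[ℝ] Rd d) ((adjointEquiv A).symm ξ) = ξ :=
    (adjointEquiv A).apply_symm_apply ξ
  rw [fourier_schwartzComp, norm_smul, mul_pow, Real.norm_of_nonneg (abs_nonneg _), h,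
    LinearMap.id_apply]
  ring

/-! ### Density of test functions -/

theorem aemeasurable_energy (k : ℕ) (u : L2 d) : AEMeasurable fun ξ : Rd d =>
    ENNReal.ofReal ((2 * Real.pi * ‖ξ‖) ^ (2 * k) * ‖(𝓕 u : L2 d) ξ‖ ^ 2) := by
  have := (Lp.aestronglyMeasurable (𝓕 u : L2 d)).aemeasurable
  fun_prop

/-- Young's inequality under the integral; it serves as a triangle inequality without square roots
and allows infinite energies. -/
theorem energy_add_le (k : ℕ) (u v : L2 d) {δ : ℝ} (hδ : 0 < δ) :
    energy k (u + v) ≤ ENNReal.ofReal (1 + δ) * energy k u +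
      ENNReal.ofReal (1 + δ⁻¹) * energy k v := by
  rw [energy, energy, energy, ← lintegral_const_mul'' _ (aemeasurable_energy k u),
    ← lintegral_const_mul'' _ (aemeasurable_energy k v),
    ← lintegral_add_left' ((aemeasurable_energy k u).const_mul _), FourierTransform.fourier_add]
  refine lintegral_mono_ae ?_
  filter_upwards [Lp.coeFn_add (𝓕 u : L2 d) (𝓕 v)] with ξ hξ
  rw [hξ, Pi.add_apply, ← ENNReal.ofReal_mul (by positivity), ← ENNReal.ofReal_mul (by positivity),
    ← ENNReal.ofReal_add (by positivity) (by positivity)]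
  refine ENNReal.ofReal_le_ofReal ?_
  set a := ‖(𝓕 u : L2 d) ξ‖
  set b := ‖(𝓕 v : L2 d) ξ‖
  have h1 : ‖(𝓕 u : L2 d) ξ + (𝓕 v : L2 d) ξ‖ ^ 2 ≤ (a + b) ^ 2 :=
    pow_le_pow_left₀ (norm_nonneg _) (norm_add_le _ _) 2
  have h2 : (a + b) ^ 2 ≤ (1 + δ) * a ^ 2 + (1 + δ⁻¹) * b ^ 2 := by
    have : (1 + δ) * a ^ 2 + (1 + δ⁻¹) * b ^ 2 - (a + b) ^ 2 = δ⁻¹ * (δ * a - b) ^ 2 := by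
      field_simp; ring
    have h3 : 0 ≤ δ⁻¹ * (δ * a - b) ^ 2 := by positivity
    linarith
  calc _ ≤ (2 * Real.pi * ‖ξ‖) ^ (2 * k) * ((1 + δ) * a ^ 2 + (1 + δ⁻¹) * b ^ 2) :=
        mul_le_mul_of_nonneg_left (h1.trans h2) (by positivity)
    _ = _ := by ring

theorem energy_neg (k : ℕ) (u : L2 d) : energy k (-u) = energy k u := by
  have h : (𝓕 (-u) : L2 d) = -𝓕 u := (Lp.fourierTransformₗᵢ (Rd d) ℂ).map_neg u
  rw [energy, energy, h]
  refine lintegral_congr_ae ?_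
  filter_upwards [Lp.coeFn_neg (𝓕 u : L2 d)] with ξ hξ
  rw [hξ, Pi.neg_apply, norm_neg]

theorem energy_sub_comm (k : ℕ) (u v : L2 d) : energy k (u - v) = energy k (v - u) := by
  rw [← energy_neg, neg_sub]

/-- Pointwise `t ≤ 1 + t²` for `t = (2π|ξ|)²`. The norm defining `H02` therefore also controls the
Dirichlet integral. -/
theorem energy_one_le (u : L2 d) : energy 1 u ≤ energy 0 u + energy 2 u := by
  rw [energy, energy, energy, ← lintegral_add_left' (aemeasurable_energy 0 u)]
  refine lintegral_mono fun ξ => ?_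
  rw [← ENNReal.ofReal_add (by positivity) (by positivity), ← add_mul]
  refine ENNReal.ofReal_le_ofReal (mul_le_mul_of_nonneg_right ?_ (by positivity))
  rw [mul_zero, pow_zero, mul_one, pow_mul]
  nlinarith [sq_nonneg ((2 * Real.pi * ‖ξ‖) ^ 2 - 1)]

theorem eq_zero_of_energy_one_eq_zero (hd : d ≠ 0) {u : L2 d} (h : energy 1 u = 0) : u = 0 := by
  have : Nonempty (Fin d) := ⟨⟨0, Nat.pos_of_ne_zero hd⟩⟩
  rw [energy, lintegral_eq_zero_iff' (aemeasurable_energy 1 u)] at h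
  have h1 : (𝓕 u : L2 d) = 0 := by
    rw [Lp.eq_zero_iff_ae_eq_zero]
    filter_upwards [h, Measure.ae_ne volume (0 : Rd d)] with ξ hξ hξ0
    rw [Pi.zero_apply, ENNReal.ofReal_eq_zero] at hξ
    by_contra hne
    have hne' : (𝓕 u : L2 d) ξ ≠ 0 := hne
    have : 0 < (2 * Real.pi * ‖ξ‖) ^ (2 * 1) * ‖(𝓕 u : L2 d) ξ‖ ^ 2 := by positivity
    linarith
  rw [← norm_eq_zero, ← Lp.norm_fourier_eq, h1, norm_zero]

theorem energy_ne_top_of_mem_H02 {Ω : Set (Rd d)} {u : L2 d} (hu : u ∈ H02 Ω) {k : ℕ}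
    (hk : k = 1 ∨ k = 2) : energy k u ≠ ∞ := by
  obtain ⟨φ, -, -, hφ⟩ := hu 1 one_pos
  have h1 : energy k (u - φ.toLp 2 volume) ≠ ∞ := by
    refine ne_top_of_lt (lt_of_le_of_lt ?_ hφ)
    rcases hk with rfl | rfl
    · exact energy_one_le _
    · exact le_add_self
  have h2 := energy_add_le k (u - φ.toLp 2 volume) (φ.toLp 2 volume) one_pos
  rw [sub_add_cancel] at h2
  exact ne_top_of_le_ne_top (ENNReal.add_ne_top.mpr
    ⟨ENNReal.mul_ne_top ENNReal.ofReal_ne_top h1,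
      ENNReal.mul_ne_top ENNReal.ofReal_ne_top (energy_toLp_ne_top k φ)⟩) h2

theorem toReal_energy_le_add (k : ℕ) {u v : L2 d} (hu : energy k u ≠ ∞)
    (huv : energy k (u - v) ≠ ∞) {δ : ℝ} (hδ : 0 < δ) :
    (energy k v).toReal ≤ (1 + δ) * (energy k u).toReal +
      (1 + δ⁻¹) * (energy k (u - v)).toReal := by
  have h := energy_add_le k u (v - u) hδ
  rw [add_sub_cancel, energy_sub_comm k v u] at h
  have h1 := ENNReal.toReal_mono (ENNReal.add_ne_top.mpr
    ⟨ENNReal.mul_ne_top ENNReal.ofReal_ne_top hu,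
      ENNReal.mul_ne_top ENNReal.ofReal_ne_top huv⟩) h
  rwa [ENNReal.toReal_add (ENNReal.mul_ne_top ENNReal.ofReal_ne_top hu)
    (ENNReal.mul_ne_top ENNReal.ofReal_ne_top huv), ENNReal.toReal_mul, ENNReal.toReal_mul,
    ENNReal.toReal_ofReal (by positivity), ENNReal.toReal_ofReal (by positivity)] at h1

/-- Approximation by a test function with error `ε` costs factors `1 + δ` and terms of order `ε / δ`
for small `δ`; hence `ε → 0` comes before `δ → 0`. -/
theorem mul_energy_one_le_of_test {Ω : Set (Rd d)} {r : ℝ} (hr : 0 ≤ r)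
    (h : ∀ φ : 𝓢(Rd d, ℂ), HasCompactSupport φ → tsupport φ ⊆ Ω →
      r * weightedEnergy 1 LinearMap.id φ ≤ weightedEnergy 2 LinearMap.id φ)
    {u : L2 d} (hu : u ∈ H02 Ω) : r * (energy 1 u).toReal ≤ (energy 2 u).toReal := by
  have hδ : ∀ δ : ℝ, 0 < δ → r * (energy 1 u).toReal ≤ (1 + δ) ^ 2 * (energy 2 u).toReal := by
    intro δ hδ
    have hε : ∀ ε : ℝ, 0 < ε → r * (energy 1 u).toReal ≤ (1 + δ) ^ 2 * (energy 2 u).toReal +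
        ((1 + δ) * (1 + δ⁻¹) + r * (1 + δ⁻¹)) * ε := by
      intro ε hε
      obtain ⟨φ, hc, hs, hφ⟩ := hu (ENNReal.ofReal ε) (ENNReal.ofReal_pos.mpr hε)
      set v : L2 d := φ.toLp 2 volume with hv
      have l1 : energy 1 (u - v) ≤ ENNReal.ofReal ε := (energy_one_le _).trans hφ.le
      have l2 : energy 2 (u - v) ≤ ENNReal.ofReal ε := le_add_self.trans hφ.le
      have t1 := ne_top_of_le_ne_top ENNReal.ofReal_ne_top l1
      have t2 := ne_top_of_le_ne_top ENNReal.ofReal_ne_top l2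
      have e1 := ENNReal.toReal_le_of_le_ofReal hε.le l1
      have e2 := ENNReal.toReal_le_of_le_ofReal hε.le l2
      have a1 := toReal_energy_le_add 1 (energy_toLp_ne_top 1 φ)
        (by rwa [energy_sub_comm]) hδ (v := u)
      have a2 := toReal_energy_le_add 2 (energy_ne_top_of_mem_H02 hu (Or.inr rfl)) t2 hδ
      rw [energy_sub_comm, ← hv] at a1
      have hv1 : (energy 1 v).toReal = weightedEnergy 1 LinearMap.id φ := by
        rw [hv, energy_toLp, ENNReal.toReal_ofReal (weightedEnergy_nonneg _ _ _)]
      have hv2 : (energy 2 v).toReal = weightedEnergy 2 LinearMap.id φ := by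
        rw [hv, energy_toLp, ENNReal.toReal_ofReal (weightedEnergy_nonneg _ _ _)]
      have h3 := h φ hc hs
      rw [← hv1, ← hv2] at h3
      calc r * (energy 1 u).toReal
          ≤ r * ((1 + δ) * (energy 1 v).toReal + (1 + δ⁻¹) * ε) := by
            gcongr; exact a1.trans (by gcongr)
        _ = (1 + δ) * (r * (energy 1 v).toReal) + r * (1 + δ⁻¹) * ε := by ring
        _ ≤ (1 + δ) * ((1 + δ) * (energy 2 u).toReal + (1 + δ⁻¹) * ε) + r * (1 + δ⁻¹) * ε := by
            gcongr; exact h3.trans (a2.trans (by gcongr))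
        _ = _ := by ring
    refine le_of_forall_pos_le_add fun η hη => ?_
    have hC : 0 < (1 + δ) * (1 + δ⁻¹) + r * (1 + δ⁻¹) := by positivity
    have := hε (η / ((1 + δ) * (1 + δ⁻¹) + r * (1 + δ⁻¹))) (by positivity)
    rwa [mul_div_cancel₀ _ hC.ne'] at this
  have hlim : Filter.Tendsto (fun δ : ℝ => (1 + δ) ^ 2 * (energy 2 u).toReal)
      (nhdsWithin 0 (Set.Ioi 0)) (nhds ((1 + 0) ^ 2 * (energy 2 u).toReal)) :=
    tendsto_nhdsWithin_of_tendsto_nhds (Continuous.tendsto (by fun_prop) 0)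
  have := ge_of_tendsto hlim (Filter.eventually_of_mem self_mem_nhdsWithin hδ)
  simpa using this

/-! ### The buckling eigenvalue through test functions -/

theorem toLp_mem_H02 {Ω : Set (Rd d)} {φ : 𝓢(Rd d, ℂ)} (hc : HasCompactSupport φ)
    (hs : tsupport φ ⊆ Ω) : φ.toLp 2 volume ∈ H02 Ω := by
  intro ε hε
  refine ⟨φ, hc, hs, ?_⟩
  have h : ∀ k, energy k (0 : L2 d) = 0 := fun k => by
    have h0 : (0 : L2 d) = (0 : 𝓢(Rd d, ℂ)).toLp 2 volume := rfl
    have h1 : 𝓕 (0 : 𝓢(Rd d, ℂ)) = 0 := (SchwartzMap.fourierTransformCLM ℂ).map_zero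
    rw [h0, energy_toLp, weightedEnergy, h1]
    simp
  simpa [h] using hε

theorem bucklingEigenvalue_nonneg (Ω : Set (Rd d)) : 0 ≤ bucklingEigenvalue Ω :=
  Real.sInf_nonneg fun r ⟨u, _, _, hr⟩ => by rw [hr]; positivity

theorem bucklingEigenvalue_mul_le {Ω : Set (Rd d)} {φ : 𝓢(Rd d, ℂ)} (hc : HasCompactSupport φ)
    (hs : tsupport φ ⊆ Ω) :
    bucklingEigenvalue Ω * weightedEnergy 1 LinearMap.id φ ≤ weightedEnergy 2 LinearMap.id φ := by
  have h1 := weightedEnergy_nonneg 1 LinearMap.id φ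
  have h2 := weightedEnergy_nonneg 2 LinearMap.id φ
  rcases h1.eq_or_lt with h0 | h0
  · simpa [← h0] using h2
  rw [← le_div_iff₀ h0]
  refine csInf_le ⟨0, fun r ⟨u, _, _, hr⟩ => by rw [hr]; positivity⟩
    ⟨φ.toLp 2 volume, toLp_mem_H02 hc hs, fun h => ?_, ?_⟩
  · have h3 : φ = 0 := SchwartzMap.injective_toLp 2 volume h
    have h4 : 𝓕 (0 : 𝓢(Rd d, ℂ)) = 0 := (SchwartzMap.fourierTransformCLM ℂ).map_zero
    rw [h3, weightedEnergy, h4] at h0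
    simp at h0
  · rw [energy_toLp, energy_toLp, ENNReal.toReal_ofReal h1, ENNReal.toReal_ofReal h2]

theorem exists_test_function {Ω : Set (Rd d)} (hΩ : IsOpen Ω) (hne : Ω.Nonempty) :
    ∃ φ : 𝓢(Rd d, ℂ), HasCompactSupport φ ∧ tsupport φ ⊆ Ω ∧ φ ≠ 0 := by
  obtain ⟨x, hx⟩ := hne
  obtain ⟨ε, hε, hball⟩ := Metric.nhds_basis_closedBall.mem_iff.mp (hΩ.mem_nhds hx)
  let f : ContDiffBump x := ⟨ε / 2, ε, by positivity, by linarith⟩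
  have hc : HasCompactSupport fun y => (f y : ℂ) :=
    f.hasCompactSupport.comp_left Complex.ofReal_zero
  have hsm : ContDiff ℝ (⊤ : ℕ∞) fun y => (f y : ℂ) := Complex.ofRealCLM.contDiff.comp f.contDiff
  refine ⟨hc.toSchwartzMap hsm, hc, ?_, fun h => ?_⟩
  · refine (closure_mono ?_).trans (f.tsupport_eq.trans_subset hball)
    intro y hy
    simpa using hy
  · have h1 : (f x : ℂ) = 0 := congrArg (fun g : 𝓢(Rd d, ℂ) => g x) h
    rw [f.one_of_mem_closedBall (Metric.mem_closedBall_self (by positivity))] at h1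
    simp at h1

theorem le_bucklingEigenvalue (hd : d ≠ 0) {Ω : Set (Rd d)} (hΩ : IsOpen Ω) (hne : Ω.Nonempty)
    {r : ℝ} (hr : 0 ≤ r) (h : ∀ φ : 𝓢(Rd d, ℂ), HasCompactSupport φ → tsupport φ ⊆ Ω →
      r * weightedEnergy 1 LinearMap.id φ ≤ weightedEnergy 2 LinearMap.id φ) :
    r ≤ bucklingEigenvalue Ω := by
  obtain ⟨φ, hc, hs, hφ⟩ := exists_test_function hΩ hne
  -- A nonzero trial function is needed: the infimum of an empty set of reals is `0` by convention.
  refine le_csInf ⟨_, φ.toLp 2 volume, toLp_mem_H02 hc hs, fun h0 =>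
    hφ (SchwartzMap.injective_toLp 2 volume h0), rfl⟩ ?_
  rintro _ ⟨u, hu, hu0, rfl⟩
  have h1 : 0 < (energy 1 u).toReal := ENNReal.toReal_pos
    (fun h1 => hu0 (eq_zero_of_energy_one_eq_zero hd h1))
    (energy_ne_top_of_mem_H02 hu (Or.inl rfl))
  rw [le_div_iff₀ h1]
  exact mul_energy_one_le_of_test hr h hu

/-! ### Linear images of a plate -/

theorem bucklingEigenvalue_mul_le_schwartzComp {Ω : Set (Rd d)} (A : Rd d ≃ₗ[ℝ] Rd d)
    {φ : 𝓢(Rd d, ℂ)} (hc : HasCompactSupport φ) (hs : tsupport φ ⊆ Ω) :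
    bucklingEigenvalue (A ⁻¹' Ω) * weightedEnergy 1 (LinearMap.adjoint (A : Rd d →ₗ[ℝ] Rd d)) φ ≤
      weightedEnergy 2 (LinearMap.adjoint (A : Rd d →ₗ[ℝ] Rd d)) φ := by
  obtain ⟨K, hK, hKφ⟩ := exists_weightedEnergy_schwartzComp A
  let e : Rd d ≃ₜ Rd d := A.toContinuousLinearEquiv.toHomeomorph
  have hc' : HasCompactSupport (schwartzComp A φ) := hc.comp_homeomorph e
  have hs' : tsupport (schwartzComp A φ) ⊆ A ⁻¹' Ω :=
    (tsupport_comp_eq_preimage φ e).trans_subset (Set.preimage_mono hs)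
  have h := bucklingEigenvalue_mul_le hc' hs'
  rw [hKφ, hKφ, mul_left_comm] at h
  exact le_of_mul_le_mul_left h hK

theorem weightedEnergy_eq (k : ℕ) (B : Rd d →ₗ[ℝ] Rd d) (φ : 𝓢(Rd d, ℂ)) :
    weightedEnergy k B φ =
      (2 * Real.pi) ^ (2 * k) * ∫ ξ : Rd d, ‖B ξ‖ ^ (2 * k) * ‖𝓕 φ ξ‖ ^ 2 := by
  rw [weightedEnergy, ← integral_const_mul]
  congr with ξ
  ring

theorem singularSum_pos (hd : d ≠ 0) (n : ℕ) (T : Rd d ≃ₗ[ℝ] Rd d) :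
    0 < singularSum n (T : Rd d →ₗ[ℝ] Rd d) := by
  have : Nonempty (Fin d) := ⟨⟨0, Nat.pos_of_ne_zero hd⟩⟩
  have h := LinearMap.injective_iff_forall_lt_finrank_singularValues_pos _ |>.mp
    (show Function.Injective (T : Rd d →ₗ[ℝ] Rd d) from T.injective)
  exact Finset.sum_pos (fun i _ => pow_pos (h i (by simp)) n) Finset.univ_nonempty

theorem quadraticMean_pos (hd : d ≠ 0) (T : Rd d ≃ₗ[ℝ] Rd d) :
    0 < quadraticMean (T : Rd d →ₗ[ℝ] Rd d) :=
  div_pos (singularSum_pos hd 2 T) (Nat.cast_pos.mpr (Nat.pos_of_ne_zero hd))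

theorem quarticMean_pos (hd : d ≠ 0) (T : Rd d ≃ₗ[ℝ] Rd d) :
    0 < quarticMean (T : Rd d →ₗ[ℝ] Rd d) := by
  have h2 := singularSum_pos hd 2 T
  have h4 := singularSum_pos hd 4 T
  have : (0 : ℝ) < d := Nat.cast_pos.mpr (Nat.pos_of_ne_zero hd)
  unfold quarticMean
  positivity

/-- This is where the symmetry enters: the same plate `T(Ω)` is parametrised by every `TU`. -/
theorem image_eq_preimage_symm_comp {Ω : Set (Rd d)} (T : Rd d ≃ₗ[ℝ] Rd d)
    {U : Rd d ≃ₗᵢ[ℝ] Rd d} (hU : U ∈ isometryGroup Ω) :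
    T '' Ω = (T.symm.trans U.symm.toLinearEquiv) ⁻¹' Ω := by
  have hU' : U '' Ω = Ω := hU
  ext x
  rw [LinearEquiv.image_eq_preimage_symm, Set.mem_preimage, Set.mem_preimage]
  conv_lhs => rw [← hU']
  exact ⟨fun ⟨y, hy, h⟩ => by
    change U.symm (T.symm x) ∈ Ω
    rwa [← h, U.symm_apply_apply], fun h => ⟨_, h, U.apply_symm_apply _⟩⟩

theorem adjoint_trans_symm_apply (T : Rd d ≃ₗ[ℝ] Rd d) (U : Rd d ≃ₗᵢ[ℝ] Rd d) (x : Rd d) :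
    LinearMap.adjoint (T.symm.trans U.symm.toLinearEquiv : Rd d →ₗ[ℝ] Rd d) x =
      LinearMap.adjoint (T.symm : Rd d →ₗ[ℝ] Rd d) (U x) := by
  refine ext_inner_left ℝ fun y => ?_
  rw [LinearMap.adjoint_inner_right, LinearMap.adjoint_inner_right]
  change inner ℝ (U.symm (T.symm y)) x = inner ℝ (T.symm y) (U x)
  rw [← U.inner_map_map, U.apply_symm_apply]

/-- `Λ(T(Ω))` is at most the ratio of the quartic and quadratic means of `T⁻¹` times `Λ(Ω)`. -/
theorem bucklingEigenvalue_image_le (hd : d ≠ 0) {Ω : Set (Rd d)} (hΩ : IsOpen Ω)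
    (hne : Ω.Nonempty) (hG : AdmitsFrames 2 (isometryGroup Ω)) (T : Rd d ≃ₗ[ℝ] Rd d) :
    bucklingEigenvalue (T '' Ω) ≤ quarticMean (T.symm : Rd d →ₗ[ℝ] Rd d) /
      quadraticMean (T.symm : Rd d →ₗ[ℝ] Rd d) * bucklingEigenvalue Ω := by
  have h4 := quarticMean_pos hd T.symm
  have h2 := quadraticMean_pos hd T.symm
  set Λ := bucklingEigenvalue (T '' Ω)
  have hΛ : 0 ≤ Λ := bucklingEigenvalue_nonneg _
  set B := LinearMap.adjoint (T.symm : Rd d →ₗ[ℝ] Rd d) with hB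
  have hB4 : quarticMean B = quarticMean (T.symm : Rd d →ₗ[ℝ] Rd d) := by
    rw [quarticMean, hB, singularSum_two_adjoint, singularSum_four_adjoint, quarticMean]
  have hB2 : quadraticMean B = quadraticMean (T.symm : Rd d →ₗ[ℝ] Rd d) := by
    rw [quadraticMean, hB, singularSum_two_adjoint, quadraticMean]
  rw [← hB4] at h4 ⊢
  rw [← hB2] at h2 ⊢
  suffices h : Λ * (quadraticMean B / quarticMean B) ≤ bucklingEigenvalue Ω by
    rwa [← div_le_iff₀' (by positivity), div_div_eq_mul_div, mul_div_assoc]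
  refine le_bucklingEigenvalue hd hΩ hne (by positivity) fun φ hc hs => ?_
  have hw := integrable_norm_pow_mul_norm_sq (d := d)
  -- The weight is the fixed density `|φ̂|²`; only the symbols `|BUξ|⁴` and `|BUξ|²` vary along the
  -- orbit. The inequality averaged is that the second energy minus `Λ` times the first is
  -- nonnegative.
  have key := hG.le_average hd B (μ := volume) (w := fun ξ => ‖𝓕 φ ξ‖ ^ 2) (by fun_prop)
    (hw 4 (𝓕 φ)) (hw 2 (𝓕 φ)) ((2 * Real.pi) ^ 4) (-(Λ * (2 * Real.pi) ^ 2)) 0 (fun U hU => by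
      have h := bucklingEigenvalue_mul_le_schwartzComp (T.symm.trans U.symm.toLinearEquiv) hc hs
      rw [← image_eq_preimage_symm_comp T hU, weightedEnergy_eq, weightedEnergy_eq] at h
      simp only [adjoint_trans_symm_apply, mul_one] at h
      norm_num only at h
      change Λ * _ ≤ _ at h
      rw [← hB] at h
      linarith)
  rw [weightedEnergy_eq, weightedEnergy_eq]
  simp only [LinearMap.id_apply, mul_one]
  norm_num only
  rw [mul_div_assoc', div_mul_eq_mul_div, div_le_iff₀ h4]
  linarith

/-- The buckling eigenvalue of a similar plate. -/
theorem le_bucklingEigenvalue_image_of_similarity (hd : d ≠ 0) {Ω : Set (Rd d)} (hΩ : IsOpen Ω)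
    (hne : Ω.Nonempty) {S : Rd d ≃ₗ[ℝ] Rd d} {c : ℝ} (hc : c ≠ 0) {U : Rd d ≃ₗᵢ[ℝ] Rd d}
    (hS : ∀ x, S x = c • U x) :
    bucklingEigenvalue Ω ≤ c ^ 2 * bucklingEigenvalue (S '' Ω) := by
  have hΛ := bucklingEigenvalue_nonneg Ω
  have hopen : IsOpen (S '' Ω) := S.toContinuousLinearEquiv.toHomeomorph.isOpenMap _ hΩ
  rw [← div_le_iff₀' (by positivity)]
  refine le_bucklingEigenvalue hd hopen (hne.image S) (by positivity) fun φ hφ hs => ?_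
  have h := bucklingEigenvalue_mul_le_schwartzComp S hφ hs
  rw [Set.preimage_image_eq _ S.injective, weightedEnergy_eq, weightedEnergy_eq] at h
  have hadj : ∀ x, ‖LinearMap.adjoint (S : Rd d →ₗ[ℝ] Rd d) x‖ = |c| * ‖x‖ := by
    intro x
    have : LinearMap.adjoint (S : Rd d →ₗ[ℝ] Rd d) x = c • U.symm x := by
      refine ext_inner_left ℝ fun y => ?_
      rw [LinearMap.adjoint_inner_right, LinearEquiv.coe_coe, hS, inner_smul_left,
        inner_smul_right, ← U.inner_map_map y, U.apply_symm_apply]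
      rfl
    rw [this, norm_smul, LinearIsometryEquiv.norm_map, Real.norm_eq_abs]
  simp only [hadj, mul_pow, mul_assoc, integral_const_mul] at h
  rw [weightedEnergy_eq, weightedEnergy_eq]
  simp only [LinearMap.id_apply, mul_pow, mul_assoc]
  have e2 : |c| ^ (2 * 1) = c ^ 2 := by rw [mul_one, sq_abs]
  have e4 : |c| ^ (2 * 2) = c ^ 2 * c ^ 2 := by rw [pow_mul, sq_abs, sq (c ^ 2)]
  rw [e2, e4] at h
  have hc2 : 0 < c ^ 2 := by positivity
  rw [div_mul_eq_mul_div, div_le_iff₀ hc2]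
  refine le_of_mul_le_mul_left ?_ hc2
  linarith

/-! ### Volume and moments of linear images -/

theorem vol_image (T : Rd d ≃ₗ[ℝ] Rd d) (Ω : Set (Rd d)) :
    vol (T '' Ω) = |LinearMap.det (T : Rd d →ₗ[ℝ] Rd d)| * vol Ω := by
  have h := Measure.addHaar_image_linearMap (volume : Measure (Rd d)) (T : Rd d →ₗ[ℝ] Rd d) Ω
  rw [vol, vol]
  change (volume ((T : Rd d →ₗ[ℝ] Rd d) '' Ω)).toReal = _
  rw [h, ENNReal.toReal_mul, ENNReal.toReal_ofReal (abs_nonneg _)]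

/-- The determinants of `T` and `T⁻¹` cancel, so the volume factors of the functional do not depend
on `T`. -/
theorem vol_image_rpow_mul (T : Rd d ≃ₗ[ℝ] Rd d) (Ω : Set (Rd d)) (p : ℝ) :
    vol (T '' Ω) ^ p * vol (T.symm '' Ω) ^ p = (vol Ω * vol Ω) ^ p := by
  have hV : ∀ D : Set (Rd d), 0 ≤ vol D := fun D => ENNReal.toReal_nonneg
  rw [← Real.mul_rpow (hV _) (hV _), vol_image, vol_image, LinearEquiv.det_coe_symm, abs_inv]
  have : |LinearMap.det (T : Rd d →ₗ[ℝ] Rd d)| ≠ 0 := abs_ne_zero.mpr T.isUnit_det'.ne_zero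
  congr 1
  field_simp

theorem moment_image (m : ℕ) (T : Rd d ≃ₗ[ℝ] Rd d) {Ω : Set (Rd d)} (hΩ : MeasurableSet Ω) :
    moment m (T '' Ω) = |LinearMap.det (T : Rd d →ₗ[ℝ] Rd d)| * ∫ x in Ω, ‖T x‖ ^ m := by
  have hT : MeasurableSet (T '' Ω) :=
    T.toContinuousLinearEquiv.toHomeomorph.measurableEmbedding.measurableSet_image.mpr hΩ
  have h := integral_comp_linearEquiv T ((T '' Ω).indicator fun x => ‖x‖ ^ m)
  have h1 : ∀ x, (T '' Ω).indicator (fun x => ‖x‖ ^ m) (T x) =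
      Ω.indicator (fun x => ‖T x‖ ^ m) x := by
    intro x
    by_cases hx : x ∈ Ω
    · rw [Set.indicator_of_mem hx, Set.indicator_of_mem (Set.mem_image_of_mem T hx)]
    · rw [Set.indicator_of_notMem hx, Set.indicator_of_notMem]
      rwa [T.injective.mem_set_image]
  simp only [h1] at h
  rw [integral_indicator hΩ, integral_indicator hT] at h
  have : |LinearMap.det (T : Rd d →ₗ[ℝ] Rd d)| ≠ 0 := abs_ne_zero.mpr T.isUnit_det'.ne_zero
  rw [h, moment, smul_eq_mul, abs_inv, mul_inv_cancel_left₀ this]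

theorem moment_image_div (T : Rd d ≃ₗ[ℝ] Rd d) {Ω : Set (Rd d)} (hΩ : MeasurableSet Ω) :
    moment 2 (T '' Ω) / moment 4 (T '' Ω) =
      (∫ x in Ω, ‖T x‖ ^ 2) / ∫ x in Ω, ‖T x‖ ^ 4 := by
  have : |LinearMap.det (T : Rd d →ₗ[ℝ] Rd d)| ≠ 0 := abs_ne_zero.mpr T.isUnit_det'.ne_zero
  rw [moment_image 2 T hΩ, moment_image 4 T hΩ, mul_div_mul_left _ _ this]

/-- Inside the unit ball `|x|²` is bounded; outside it is at most `|x|⁴`. -/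
theorem integrableOn_norm_sq {Ω : Set (Rd d)} (h : IntegrableOn (fun x : Rd d => ‖x‖ ^ 4) Ω) :
    IntegrableOn (fun x : Rd d => ‖x‖ ^ 2) Ω := by
  have h1 : IntegrableOn (fun x : Rd d => ‖x‖ ^ 2) (Ω ∩ Metric.ball 0 1) :=
    (integrableOn_unitBall (by fun_prop)).mono_set Set.inter_subset_right
  have h2 : IntegrableOn (fun x : Rd d => ‖x‖ ^ 2) (Ω \ Metric.ball 0 1) := by
    have h3 : IntegrableOn (fun x : Rd d => ‖x‖ ^ 4) (Metric.ball 0 1)ᶜ (volume.restrict Ω) :=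
      Integrable.integrableOn h
    rw [Set.sdiff_eq, Set.inter_comm, IntegrableOn,
      ← Measure.restrict_restrict Metric.isOpen_ball.measurableSet.compl]
    refine h3.mono' (by fun_prop) ?_
    filter_upwards [ae_restrict_mem Metric.isOpen_ball.measurableSet.compl] with x hx
    have hx1 : 1 ≤ ‖x‖ := by simpa using hx
    rw [Real.norm_of_nonneg (by positivity)]
    exact pow_le_pow_right₀ hx1 (by norm_num)
  simpa [Set.inter_union_sdiff] using h1.union h2

theorem measurePreserving_restrict {Ω : Set (Rd d)} (hΩ : MeasurableSet Ω)
    {U : Rd d ≃ₗᵢ[ℝ] Rd d} (hU : U ∈ isometryGroup Ω) :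
    MeasurePreserving U (volume.restrict Ω) (volume.restrict Ω) := by
  have hU' : U '' Ω = Ω := hU
  have h := U.measurePreserving.restrict_preimage hΩ
  have h2 : U ⁻¹' Ω = Ω := by
    conv_lhs => rw [← hU']
    exact Set.preimage_image_eq _ U.injective
  rwa [h2] at h

theorem bucklingFunctional_eq (Ω : Set (Rd d)) (hΩ : MeasurableSet Ω) (T : Rd d ≃ₗ[ℝ] Rd d) :
    bucklingFunctional Ω T = bucklingEigenvalue (T '' Ω) * (vol Ω * vol Ω) ^ (2 / (d : ℝ)) *
      ((∫ x in Ω, ‖T.symm x‖ ^ 2) / ∫ x in Ω, ‖T.symm x‖ ^ 4) := by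
  rw [bucklingFunctional, ← vol_image_rpow_mul T, ← moment_image_div T.symm hΩ]
  ring

/-- The moment ratio contributes `quadraticMean / quarticMean` of `T⁻¹`, the inverse of the factor
in `bucklingEigenvalue_image_le`. -/
theorem bucklingFunctional_le (hd : d ≠ 0) {Ω : Set (Rd d)} (hΩ : IsOpen Ω) (hne : Ω.Nonempty)
    (hG : AdmitsFrames 2 (isometryGroup Ω)) (h4 : IntegrableOn (fun x : Rd d => ‖x‖ ^ 4) Ω)
    (T : Rd d ≃ₗ[ℝ] Rd d) :
    bucklingFunctional Ω T ≤ bucklingEigenvalue Ω * (vol Ω * vol Ω) ^ (2 / (d : ℝ)) *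
      (moment 2 Ω / moment 4 Ω) := by
  have h2 := integrableOn_norm_sq h4
  have hμ := fun U hU => measurePreserving_restrict hΩ.measurableSet (U := U) hU
  have e4 := hG.integral_norm_pow_four hd (T.symm : Rd d →ₗ[ℝ] Rd d) h4 h2 hμ
  have e2 := hG.integral_norm_sq hd (T.symm : Rd d →ₗ[ℝ] Rd d) h4 h2 hμ
  simp only [LinearEquiv.coe_coe] at e4 e2
  have p4 := quarticMean_pos hd T.symm
  have p2 := quadraticMean_pos hd T.symm
  have hΛ := bucklingEigenvalue_image_le hd hΩ hne hG T
  have hmom : 0 ≤ moment 2 Ω / moment 4 Ω :=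
    div_nonneg (integral_nonneg fun _ => by positivity) (integral_nonneg fun _ => by positivity)
  have hV : 0 ≤ (vol Ω * vol Ω) ^ (2 / (d : ℝ)) := Real.rpow_nonneg (mul_self_nonneg _) _
  rw [bucklingFunctional_eq Ω hΩ.measurableSet, e4, e2, mul_div_mul_comm, ← mul_assoc]
  refine mul_le_mul_of_nonneg_right ?_ hmom
  rw [mul_right_comm]
  refine mul_le_mul_of_nonneg_right ?_ hV
  rw [← le_div_iff₀ (by positivity)]
  refine hΛ.trans_eq ?_
  field_simp

theorem le_bucklingFunctional_of_similarity (hd : d ≠ 0) {Ω : Set (Rd d)} (hΩ : IsOpen Ω)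
    (hne : Ω.Nonempty) {S : Rd d ≃ₗ[ℝ] Rd d} {c : ℝ} {U : Rd d ≃ₗᵢ[ℝ] Rd d}
    (hS : ∀ x, S x = c • U x) :
    bucklingEigenvalue Ω * (vol Ω * vol Ω) ^ (2 / (d : ℝ)) * (moment 2 Ω / moment 4 Ω) ≤
      bucklingFunctional Ω S := by
  have : Nonempty (Fin d) := ⟨⟨0, Nat.pos_of_ne_zero hd⟩⟩
  -- In positive dimension an invertible `S` cannot vanish identically.
  have hc : c ≠ 0 := by
    rintro rfl
    obtain ⟨x, hx⟩ := exists_ne (0 : Rd d)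
    exact hx (S.map_eq_zero_iff.mp (by simp [hS]))
  have hn : ∀ x, ‖S.symm x‖ = |c|⁻¹ * ‖x‖ := by
    intro x
    have h := congrArg norm (hS (S.symm x))
    rw [S.apply_symm_apply, norm_smul, LinearIsometryEquiv.norm_map, Real.norm_eq_abs] at h
    rw [h, inv_mul_cancel_left₀ (abs_ne_zero.mpr hc)]
  have hΛ := le_bucklingEigenvalue_image_of_similarity hd hΩ hne hc hS
  have hmom : 0 ≤ moment 2 Ω / moment 4 Ω :=
    div_nonneg (integral_nonneg fun _ => by positivity) (integral_nonneg fun _ => by positivity)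
  have hV : 0 ≤ (vol Ω * vol Ω) ^ (2 / (d : ℝ)) := Real.rpow_nonneg (mul_self_nonneg _) _
  rw [bucklingFunctional_eq Ω hΩ.measurableSet]
  simp only [hn, mul_pow, integral_const_mul]
  have e : |c|⁻¹ ^ 2 / |c|⁻¹ ^ 4 = c ^ 2 := by
    have : |c| ≠ 0 := abs_ne_zero.mpr hc
    rw [← sq_abs c]
    field_simp
  rw [mul_div_mul_comm, e, ← mul_assoc]
  refine mul_le_mul_of_nonneg_right ?_ hmom
  rw [mul_right_comm]
  refine mul_le_mul_of_nonneg_right ?_ hV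
  rwa [mul_comm]

end Buckling

end

theorem mainTheorem8 (d : ℕ) (hd : 1 ≤ d) (Ω : Set (Buckling.Rd d))
    (hopen : IsOpen Ω) (hconn : IsConnected Ω)
    (hframe : Buckling.AdmitsFrames 2 (Buckling.isometryGroup Ω)) :
    (∀ T : Buckling.Rd d ≃ₗ[ℝ] Buckling.Rd d,
      Buckling.bucklingEigenvalue (T '' Ω) ≤
        (Buckling.schattenNorm 2 (T.symm : Buckling.Rd d →ₗ[ℝ] Buckling.Rd d) ^ 4 +
            2 * Buckling.schattenNorm 4 (T.symm : Buckling.Rd d →ₗ[ℝ] Buckling.Rd d) ^ 4) /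
          (((d : ℝ) + 2) *
            Buckling.schattenNorm 2 (T.symm : Buckling.Rd d →ₗ[ℝ] Buckling.Rd d) ^ 2) *
        Buckling.bucklingEigenvalue Ω) ∧
    (IntegrableOn (fun x : Buckling.Rd d => ‖x‖ ^ 4) Ω →
      ∀ (S : Buckling.Rd d ≃ₗ[ℝ] Buckling.Rd d) (c : ℝ)
        (U : Buckling.Rd d ≃ₗᵢ[ℝ] Buckling.Rd d), (∀ x, S x = c • U x) →
        ∀ T : Buckling.Rd d ≃ₗ[ℝ] Buckling.Rd d,
          Buckling.bucklingFunctional Ω T ≤ Buckling.bucklingFunctional Ω S) := by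
  have hd' : d ≠ 0 := Nat.one_le_iff_ne_zero.mp hd
  -- The values at `T` and at the similarity `S` are compared through the value at the identity.
  refine ⟨fun T => ?_, fun h4 S c U hS T =>
    (Buckling.bucklingFunctional_le hd' hopen hconn.nonempty hframe h4 T).trans
      (Buckling.le_bucklingFunctional_of_similarity hd' hopen hconn.nonempty hS)⟩
  refine (Buckling.bucklingEigenvalue_image_le hd' hopen hconn.nonempty hframe T).trans_eq ?_
  have h2 := Buckling.singularSum_pos hd' 2 T.symm
  have hd0 : (d : ℝ) ≠ 0 := Nat.cast_ne_zero.mpr hd'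
  have hd2 : (d : ℝ) + 2 ≠ 0 := by positivity
  rw [← Buckling.schattenNorm_pow two_ne_zero] at h2
  rw [Buckling.quarticMean, Buckling.quadraticMean, ← Buckling.schattenNorm_pow two_ne_zero,
    ← Buckling.schattenNorm_pow four_ne_zero]
  field_simp
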